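/- Let $e^1,e^2,e^3$ be invariant 1-forms on the unit sphere $S^3$ with $de^1=2e^2\wedge e^3$, $de^2=2e^3\wedge e^1$, $de^3=2e^1\wedge e^2$. Let $J\subseteq\mathbb{R}$ be an open interval, let $A_1,A_2:J\to\mathbb{R}$ be smooth functions without zeros, and let $g=dt^2+A_1(t)^2(e^1)^2+A_2(t)^2\big((e^2)^2+(e^3)^2\big)$ on $J\times S^3$. Suppose that $g$ is Einstein but not Ricci-flat, that the functions $A_1,A_2$ do not coincide, and that for some real constants $k_1,k_2,k_3,l_1,l_2,l_3$ $$A_1'=k_1\Big(\frac{A_1}{A_2}\Big)^2+k_2\frac{A_1}{A_2}+k_3,\qquad A_2'=l_1\Big(\frac{A_1}{A_2}\Big)^2+l_2\frac{A_1}{A_2}+l_3 \quad\text{on } J. \tag{1}$$ Then $(k_1,k_2,k_3,l_1,l_2,l_3)=s\,(2,0,-1,0,1,0)$ for some $s\in\{1,-1\}$, and there are $\alpha>0$, $c\in\mathbb{R}$ and $\varepsilon\in\{1,-1\}$ such that one of the following holds. (a) $A_1(t)=\frac{\sin(2\alpha(st+c))}{2\alpha}$ and $A_2(t)=\varepsilon\,\frac{\sin(\alpha(st+c))}{\alpha}$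 on $J$, and $(J\times S^3,g)$ is isometric to an open subset of $\mathbb{C}P^2$ with the metric $\alpha^{-2}g_{FS}$, where $g_{FS}$ is the Fubini–Study metric with sectional curvatures in $[1,4]$. (b) $A_1(t)=\frac{\sinh(2\alpha(st+c))}{2\alpha}$ and $A_2(t)=\varepsilon\,\frac{\sinh(\alpha(st+c))}{\alpha}$ on $J$ (that is, $\alpha$ is replaced by $\mathrm{i}\alpha$), and $(J\times S^3,g)$ is isometric to an open subset of the complex hyperbolic plane $SU(1,2)/S(U(1)\times U(2))$ with the metric $\alpha^{-2}g_{H}$, where $g_{H}$ is the hyperbolic counterpart of $g_{FS}$, with sectional curvatures in $[-4,-1]$. -/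

import Mathlib

open scoped Manifold ContDiff Quaternion LinearAlgebra.Projectivization

noncomputable section

namespace CohomogeneityOne

/-! ## Curvature of a metric in local coordinates -/

section Coordinates

variable {ι E : Type*} [Fintype ι] [DecidableEq ι] [NormedAddCommGroup E] [NormedSpace ℝ E]

/-- The partial derivative `∂ₖ f` at `y`, for the linear coordinates of `E` given by the basis `b`. -/
def partialDeriv (b : Module.Basis ι ℝ E) (k : ι) (f : E → ℝ) (y : E) : ℝ :=
  fderiv ℝ f y (b k)

/-- The Christoffel symbol `Γᵏᵢⱼ = ½ gᵏˡ (∂ᵢ gⱼₗ + ∂ⱼ gᵢₗ - ∂ₗ gᵢⱼ)` of a matrix function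
`G = (gᵢⱼ)` of the coordinates. -/
def christoffel (b : Module.Basis ι ℝ E) (G : E → Matrix ι ι ℝ) (k i j : ι) (y : E) : ℝ :=
  (1 / 2) * ∑ l, (G y)⁻¹ k l *
    (partialDeriv b i (fun z => G z j l) y + partialDeriv b j (fun z => G z i l) y
      - partialDeriv b l (fun z => G z i j) y)

/-- The component `Ricᵢⱼ = ∂ₖ Γᵏᵢⱼ - ∂ⱼ Γᵏᵢₖ + Γᵏₖₗ Γˡᵢⱼ - Γᵏⱼₗ Γˡᵢₖ` of the Ricci tensor
(so that round spheres have positive Ricci curvature). -/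
def coordRicci (b : Module.Basis ι ℝ E) (G : E → Matrix ι ι ℝ) (y : E) (i j : ι) : ℝ :=
  ∑ k, (partialDeriv b k (christoffel b G k i j) y - partialDeriv b j (christoffel b G k i k) y
    + ∑ l, (christoffel b G k k l y * christoffel b G l i j y
      - christoffel b G k j l y * christoffel b G l i k y))

end Coordinates

/-! ## Einstein and Ricci-flat metrics on open subsets of a manifold -/

section Manifold

variable {ι E H M : Type*} [Fintype ι] [DecidableEq ι] [NormedAddCommGroup E] [NormedSpace ℝ E]
  [TopologicalSpace H] [TopologicalSpace M] [ChartedSpace H M]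

/-- The components `gᵢⱼ` of a metric `g` in the chart `e`, as functions of the coordinates. -/
def chartMetric (I : ModelWithCorners ℝ E H) (b : Module.Basis ι ℝ E)
    (g : ∀ x : M, TangentSpace I x → TangentSpace I x → ℝ) (e : OpenPartialHomeomorph M H) (y : E) :
    Matrix ι ι ℝ :=
  Matrix.of fun i j => g ((e.extend I).symm y)
    (mfderiv 𝓘(ℝ, E) I (e.extend I).symm y (b i)) (mfderiv 𝓘(ℝ, E) I (e.extend I).symm y (b j))

/-- The metric `g` satisfies `Ric = Λ g` on the open set `U`: the equation holds for the components
in every smooth chart (of a manifold without boundary). -/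
def RicciEqSMul (I : ModelWithCorners ℝ E H) [I.Boundaryless] (b : Module.Basis ι ℝ E)
    (g : ∀ x : M, TangentSpace I x → TangentSpace I x → ℝ) (U : Set M) (Λ : ℝ) : Prop :=
  ∀ e ∈ IsManifold.maximalAtlas I ∞ M, ∀ y ∈ (e.extend I).target, (e.extend I).symm y ∈ U →
    ∀ i j, coordRicci b (chartMetric I b g e) y i j = Λ * chartMetric I b g e y i j

/-- `g` is an Einstein metric on the open set `U`: `Ric = Λ g` for some constant `Λ`. -/
def IsEinstein (I : ModelWithCorners ℝ E H) [I.Boundaryless] (b : Module.Basis ι ℝ E)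
    (g : ∀ x : M, TangentSpace I x → TangentSpace I x → ℝ) (U : Set M) : Prop :=
  ∃ Λ : ℝ, RicciEqSMul I b g U Λ

/-- `g` is Ricci-flat on the open set `U`: `Ric = 0`. -/
def IsRicciFlat (I : ModelWithCorners ℝ E H) [I.Boundaryless] (b : Module.Basis ι ℝ E)
    (g : ∀ x : M, TangentSpace I x → TangentSpace I x → ℝ) (U : Set M) : Prop :=
  RicciEqSMul I b g U 0

end Manifold

/-! ## The metrics on `ℝ × S³` -/

instance : Fact (Module.finrank ℝ ℍ[ℝ] = 3 + 1) := ⟨Quaternion.finrank_eq_four⟩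

/-- The sphere `S³` of unit quaternions. -/
abbrev S3 : Type := Metric.sphere (0 : ℍ[ℝ]) 1

/-- The manifold `ℝ × S³` is modelled on `ℝ × ℝ³`. -/
abbrev model : ModelWithCorners ℝ (ℝ × EuclideanSpace ℝ (Fin 3))
    (ModelProd ℝ (EuclideanSpace ℝ (Fin 3))) :=
  𝓘(ℝ, ℝ).prod (𝓡 3)

/-- The standard basis of `ℝ × ℝ³`. -/
def stdBasis : Module.Basis (Unit ⊕ Fin 3) ℝ (ℝ × EuclideanSpace ℝ (Fin 3)) :=
  (Module.Basis.singleton Unit ℝ).prod (EuclideanSpace.basisFun (Fin 3) ℝ).toBasis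

/-- The 1-form `dt`. -/
def dt (x : ℝ × S3) (v : TangentSpace model x) : ℝ :=
  mfderiv model 𝓘(ℝ, ℝ) (fun y : ℝ × S3 => y.1) x v

/-- The invariant quaternion-valued 1-form `dq · q⁻¹` on `S³`, where `q⁻¹` is the conjugate of the
unit quaternion `q`. It is `i e¹ + j e² + k e³` with `de¹ = 2 e² ∧ e³` and cyclically. -/
def maurerCartan (x : ℝ × S3) (v : TangentSpace model x) : ℍ[ℝ] :=
  (show ℍ[ℝ] from mfderiv model 𝓘(ℝ, ℍ[ℝ]) (fun y : ℝ × S3 => (y.2 : ℍ[ℝ])) x v) *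
    star (x.2 : ℍ[ℝ])

/-- The 1-form `e¹`. -/
def e1 (x : ℝ × S3) (v : TangentSpace model x) : ℝ := (maurerCartan x v).imI

/-- The 1-form `e²`. -/
def e2 (x : ℝ × S3) (v : TangentSpace model x) : ℝ := (maurerCartan x v).imJ

/-- The 1-form `e³`. -/
def e3 (x : ℝ × S3) (v : TangentSpace model x) : ℝ := (maurerCartan x v).imK

/-- The metric `dt² + A₁(t)² (e¹)² + A₂(t)² ((e²)² + (e³)²)`. -/
def metric (A₁ A₂ : ℝ → ℝ) (x : ℝ × S3) (u v : TangentSpace model x) : ℝ :=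
  dt x u * dt x v + A₁ x.1 ^ 2 * (e1 x u * e1 x v)
    + A₂ x.1 ^ 2 * (e2 x u * e2 x v + e3 x u * e3 x v)

/-! ## The complex projective plane and the complex hyperbolic plane

Both consist of complex lines in `ℂ³`. The parameter `σ` is `1` for the complex projective plane
and `-1` for the complex hyperbolic plane. -/

/-- The Hermitian form `σ z₀ w̄₀ + z₁ w̄₁ + z₂ w̄₂` on `ℂ³`. -/
def herm (σ : ℝ) (z w : Fin 3 → ℂ) : ℂ :=
  σ * (z 0 * star (w 0)) + z 1 * star (w 1) + z 2 * star (w 2)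

/-- The set of lines on which `σ h` is positive. For `σ = 1` these are all lines: this is `ℂP²`. For
`σ = -1` these are the negative lines of the form of signature `(2,1)`: this is the complex
hyperbolic plane `SU(1,2)/S(U(1) × U(2))`. -/
def spaceForm (σ : ℝ) : Set (ℙ ℂ (Fin 3 → ℂ)) :=
  {ℓ | 0 < σ * (herm σ ℓ.rep ℓ.rep).re}

/-- The pull-back of the invariant metric of `spaceForm σ` under the projection `z ↦ [z]`, at `z`. For
`σ = 1` it is the Fubini-Study metric with sectional curvatures in `[1, 4]`, for `σ = -1` the complex
hyperbolic metric with sectional curvatures in `[-4, -1]`. -/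
def spaceFormMetric (σ : ℝ) (z u v : Fin 3 → ℂ) : ℝ :=
  σ * (herm σ z z * herm σ u v - herm σ u z * herm σ z v).re / (herm σ z z).re ^ 2

/-- The quotient topology on the projective space. -/
instance : TopologicalSpace (ℙ ℂ (Fin 3 → ℂ)) :=
  inferInstanceAs (TopologicalSpace (Quotient (projectivizationSetoid ℂ (Fin 3 → ℂ))))

/-- On the open set `U`, the map `f` is an isometry of `g` onto an open subset of `spaceForm σ`, whose
metric is multiplied by the constant `r`: `f` is a homeomorphism of `U` onto an open subset, and it
has smooth local lifts to `ℂ³ ∖ {0}` along which the metric pulls back to `g`. -/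
structure IsIsometryOntoOpen (σ r : ℝ) (g : ∀ x : ℝ × S3, TangentSpace model x →
    TangentSpace model x → ℝ) (U : Set (ℝ × S3)) (f : ℝ × S3 → ℙ ℂ (Fin 3 → ℂ)) : Prop where
  mapsTo : Set.MapsTo f U (spaceForm σ)
  isOpenEmbedding : Topology.IsOpenEmbedding (Set.domRestrict U f)
  exists_lift : ∀ x ∈ U, ∃ V : Set (ℝ × S3), IsOpen V ∧ x ∈ V ∧ V ⊆ U ∧
    ∃ Z : ℝ × S3 → (Fin 3 → ℂ), ContMDiffOn model 𝓘(ℝ, Fin 3 → ℂ) ∞ Z V ∧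
      ∀ y ∈ V, (∃ hy : Z y ≠ 0, f y = Projectivization.mk ℂ (Z y) hy) ∧
        ∀ u v : TangentSpace model y, g y u v = r * spaceFormMetric σ (Z y)
          (mfderiv model 𝓘(ℝ, Fin 3 → ℂ) Z y u) (mfderiv model 𝓘(ℝ, Fin 3 → ℂ) Z y v)

end CohomogeneityOne

end

/-! The Einstein equation is used only at the points (t, 1) of J × S³. In central projection
coordinates the metric is diagonal there, and its second-order Taylor data give three Ricci
components, hence three ordinary differential equations for A₁, A₂ (`einstein_equations`).

Put x = A₁/A₂ and write the system as A₁' = P(x), A₂' = Q(x) with quadratics P, Q. Then x' = (P -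
xQ)/A₂, and the second derivatives are polynomials in x divided by A₂. Eliminating Λ between the
three equations removes A₂ as well and leaves two polynomial identities in x. The remaining equation
is (P' + 2xQ')(P - xQ) = -Λ A₂² x. Its right side has no zero when Λ ≠ 0, so x is not constant,
takes infinitely many values, and the identities hold coefficient by coefficient. The same equation
excludes the coefficients for which P' + 2xQ' vanishes identically, which would force Λ = 0. What is
left is P = s(2x² - 1), Q = sx (`system_coefficients`).

For these coefficients the remaining equation is the first integral x² + (Λ/6) A₂² = 1, and the
system becomes linear: A₂' = sx, x' = -s(Λ/6)A₂. With α² = |Λ|/6 the solutions are circular or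
hyperbolic functions according to the sign of Λ (`solutions_of_einstein_system`).

For the isometry, view S³ in ℂ² and map (t, z) to the line [C(t) : S(t) z], where (C, S) is (cos,
sin) or (cosh, sinh) of α(st + c). The Hermitian form is constant along this lift, and the invariant
metric pulls back to α² dt² + S²C² (e¹)² + S² ((e²)² + (e³)²), which is α² g
(`spaceFormMetric_lift`). In the affine chart the map is (t, z) ↦ (S/C) z, that is, polar
coordinates with radius tan or tanh, so it is an open embedding (`isOpenEmbedding_polar`,
`isOpenEmbedding_affineChart`). -/

noncomputable section

namespace CohomogeneityOne

/-! ### Second-order Taylor data and the Ricci tensor at a point where the metric is diagonal -/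

section Jets

variable {ι E : Type*} [NormedAddCommGroup E] [NormedSpace ℝ E]

lemma partialDeriv_add {b : Module.Basis ι ℝ E} {k : ι} {f g : E → ℝ} {y : E}
    (hf : DifferentiableAt ℝ f y) (hg : DifferentiableAt ℝ g y) :
    partialDeriv b k (fun z => f z + g z) y = partialDeriv b k f y + partialDeriv b k g y := by
  simp [partialDeriv, fderiv_fun_add hf hg]

lemma partialDeriv_sub {b : Module.Basis ι ℝ E} {k : ι} {f g : E → ℝ} {y : E}
    (hf : DifferentiableAt ℝ f y) (hg : DifferentiableAt ℝ g y) :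
    partialDeriv b k (fun z => f z - g z) y = partialDeriv b k f y - partialDeriv b k g y := by
  simp [partialDeriv, fderiv_fun_sub hf hg]

lemma partialDeriv_mul {b : Module.Basis ι ℝ E} {k : ι} {f g : E → ℝ} {y : E}
    (hf : DifferentiableAt ℝ f y) (hg : DifferentiableAt ℝ g y) :
    partialDeriv b k (fun z => f z * g z) y
      = partialDeriv b k f y * g y + f y * partialDeriv b k g y := by
  simp [partialDeriv, fderiv_fun_mul hf hg]; ring

lemma partialDeriv_const {b : Module.Basis ι ℝ E} {k : ι} {c : ℝ} {y : E} :
    partialDeriv b k (fun _ => c) y = 0 := by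
  simp [partialDeriv]

lemma partialDeriv_sum {κ : Type*} {s : Finset κ} {b : Module.Basis ι ℝ E} {k : ι}
    {f : κ → E → ℝ} {y : E} (hf : ∀ m ∈ s, DifferentiableAt ℝ (f m) y) :
    partialDeriv b k (fun z => ∑ m ∈ s, f m z) y = ∑ m ∈ s, partialDeriv b k (f m) y := by
  simp [partialDeriv, fderiv_fun_sum hf]

lemma partialDeriv_comp {b : Module.Basis ι ℝ E} {k : ι} {f : E → ℝ} {F : ℝ → ℝ} {y : E}
    (hF : DifferentiableAt ℝ F (f y)) (hf : DifferentiableAt ℝ f y) :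
    partialDeriv b k (fun z => F (f z)) y = deriv F (f y) * partialDeriv b k f y := by
  have h := (hF.hasDerivAt.comp_hasFDerivAt y hf.hasFDerivAt).fderiv
  simp only [partialDeriv]
  erw [h]
  simp

lemma partialDeriv_congr {b : Module.Basis ι ℝ E} {k : ι} {f g : E → ℝ} {y : E}
    (h : f =ᶠ[nhds y] g) : partialDeriv b k f y = partialDeriv b k g y := by
  simp [partialDeriv, h.fderiv_eq]

lemma differentiableAt_partialDeriv {b : Module.Basis ι ℝ E} {k : ι} {f : E → ℝ} {y : E}
    (h : ContDiffAt ℝ 2 f y) : DifferentiableAt ℝ (partialDeriv b k f) y := by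
  have : ContDiffAt ℝ 1 (fderiv ℝ f) y := h.fderiv_right (by norm_num)
  exact (this.differentiableAt (by norm_num)).clm_apply (differentiableAt_const _)

lemma eventually_differentiableAt {f : E → ℝ} {y : E} (h : ContDiffAt ℝ 2 f y) :
    ∀ᶠ z in nhds y, DifferentiableAt ℝ f z :=
  (h.eventually (by simp)).mono fun _ hz => hz.differentiableAt (by norm_num)

/-- The function `f` is twice continuously differentiable at `y`, with value `a`, first partial
derivatives `d` and second partial derivatives `h`. -/
structure HasTwoJet (b : Module.Basis ι ℝ E) (f : E → ℝ) (y : E) (a : ℝ) (d : ι → ℝ)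
    (h : ι → ι → ℝ) : Prop where
  contDiffAt : ContDiffAt ℝ 2 f y
  value : f y = a
  first : ∀ k, partialDeriv b k f y = d k
  second : ∀ k l, partialDeriv b k (partialDeriv b l f) y = h k l

namespace HasTwoJet

variable {b : Module.Basis ι ℝ E} {f g : E → ℝ} {y : E} {a a' : ℝ} {d d' : ι → ℝ}
  {h h' : ι → ι → ℝ}

lemma differentiableAt (H : HasTwoJet b f y a d h) : DifferentiableAt ℝ f y :=
  H.contDiffAt.differentiableAt (by norm_num)

lemma const (c : ℝ) : HasTwoJet b (fun _ => c) y c 0 0 :=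
  ⟨contDiffAt_const, rfl, fun _ => partialDeriv_const, fun k l => by
    rw [show partialDeriv b l (fun _ : E => c) = fun _ => 0 from
      funext fun _ => partialDeriv_const]
    exact partialDeriv_const⟩

lemma clm (φ : E →L[ℝ] ℝ) : HasTwoJet b φ y (φ y) (fun k => φ (b k)) 0 :=
  ⟨φ.contDiff.contDiffAt, rfl, fun _ => by simp [partialDeriv], fun k l => by
    rw [show partialDeriv b l φ = fun _ => φ (b l) from funext fun _ => by simp [partialDeriv]]
    exact partialDeriv_const⟩

lemma add (H : HasTwoJet b f y a d h) (H' : HasTwoJet b g y a' d' h') :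
    HasTwoJet b (fun z => f z + g z) y (a + a') (fun k => d k + d' k)
      (fun k l => h k l + h' k l) := by
  refine ⟨H.contDiffAt.add H'.contDiffAt, by rw [H.value, H'.value], fun k => ?_, fun k l => ?_⟩
  · rw [partialDeriv_add H.differentiableAt H'.differentiableAt, H.first, H'.first]
  · rw [partialDeriv_congr (g := fun z => partialDeriv b l f z + partialDeriv b l g z),
      partialDeriv_add (differentiableAt_partialDeriv H.contDiffAt)
        (differentiableAt_partialDeriv H'.contDiffAt), H.second, H'.second]
    filter_upwards [eventually_differentiableAt H.contDiffAt,
      eventually_differentiableAt H'.contDiffAt] with z hf hg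
    exact partialDeriv_add hf hg

lemma mul (H : HasTwoJet b f y a d h) (H' : HasTwoJet b g y a' d' h') :
    HasTwoJet b (fun z => f z * g z) y (a * a') (fun k => d k * a' + a * d' k)
      (fun k l => h k l * a' + d l * d' k + (d k * d' l + a * h' k l)) := by
  refine ⟨H.contDiffAt.mul H'.contDiffAt, by rw [H.value, H'.value], fun k => ?_, fun k l => ?_⟩
  · rw [partialDeriv_mul H.differentiableAt H'.differentiableAt, H.first, H'.first, H.value,
      H'.value]
  · have h1 := differentiableAt_partialDeriv H.contDiffAt (b := b) (k := l)
    have h2 := differentiableAt_partialDeriv H'.contDiffAt (b := b) (k := l)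
    rw [partialDeriv_congr
        (g := fun z => partialDeriv b l f z * g z + f z * partialDeriv b l g z),
      partialDeriv_add (f := fun z => partialDeriv b l f z * g z)
        (g := fun z => f z * partialDeriv b l g z) (h1.mul H'.differentiableAt)
        (H.differentiableAt.mul h2),
      partialDeriv_mul h1 H'.differentiableAt, partialDeriv_mul H.differentiableAt h2,
      H.second, H'.second, H.first, H'.first, H.first, H'.first, H.value, H'.value]
    filter_upwards [eventually_differentiableAt H.contDiffAt,
      eventually_differentiableAt H'.contDiffAt] with z hf hg
    exact partialDeriv_mul hf hg

lemma comp {F : ℝ → ℝ} {p q : ℝ} (H : HasTwoJet b f y a d h) (hF : ContDiffAt ℝ 2 F a)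
    (hp : deriv F a = p) (hq : deriv (deriv F) a = q) :
    HasTwoJet b (fun z => F (f z)) y (F a) (fun k => p * d k)
      (fun k l => q * d k * d l + p * h k l) := by
  have hfa := H.value
  subst hfa hp hq
  have hd : DifferentiableAt ℝ F (f y) := hF.differentiableAt (by norm_num)
  have hdd : DifferentiableAt ℝ (deriv F) (f y) := by
    have : ContDiffAt ℝ 1 (fderiv ℝ F) (f y) := hF.fderiv_right (by norm_num)
    have := (this.differentiableAt (by norm_num)).clm_apply (differentiableAt_const (1 : ℝ))
    simpa only [fderiv_apply_one_eq_deriv] using this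
  refine ⟨hF.comp y H.contDiffAt, rfl, fun k => ?_, fun k l => ?_⟩
  · rw [partialDeriv_comp hd H.differentiableAt, H.first]
  · have h1 := differentiableAt_partialDeriv H.contDiffAt (b := b) (k := l)
    have h2 : DifferentiableAt ℝ (fun z => deriv F (f z)) y := hdd.comp y H.differentiableAt
    rw [partialDeriv_congr (g := fun z => deriv F (f z) * partialDeriv b l f z),
      partialDeriv_mul h2 h1, partialDeriv_comp hdd H.differentiableAt, H.second, H.first, H.first]
    have hev := (hF.eventually (by simp)).mono fun _ hz => hz.differentiableAt (by norm_num)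
    filter_upwards [eventually_differentiableAt H.contDiffAt,
      H.differentiableAt.continuousAt.eventually hev] with z hf hg
    exact partialDeriv_comp hg hf

lemma congr_jet (H : HasTwoJet b f y a d h) (ha : a = a') (hd : ∀ k, d k = d' k)
    (hh : ∀ k l, h k l = h' k l) : HasTwoJet b f y a' d' h' :=
  ⟨H.contDiffAt, H.value.trans ha, fun k => (H.first k).trans (hd k),
    fun k l => (H.second k l).trans (hh k l)⟩

end HasTwoJet

variable [Fintype ι] [DecidableEq ι]

lemma differentiableAt_matrix_det {G : E → Matrix ι ι ℝ} {y : E}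
    (hG : ∀ i j, DifferentiableAt ℝ (fun z => G z i j) y) :
    DifferentiableAt ℝ (fun z => (G z).det) y := by
  simp only [Matrix.det_apply]
  refine DifferentiableAt.fun_sum fun σ _ => ?_
  have h := (HasFDerivAt.finsetProd (u := Finset.univ) (g := fun i z => G z (σ i) i)
    fun i _ => (hG _ _).hasFDerivAt).differentiableAt
  exact h.const_smul _

lemma differentiableAt_matrix_inv {G : E → Matrix ι ι ℝ} {y : E}
    (hG : ∀ i j, DifferentiableAt ℝ (fun z => G z i j) y) (hdet : (G y).det ≠ 0) (i j : ι) :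
    DifferentiableAt ℝ (fun z => (G z)⁻¹ i j) y := by
  simp only [Matrix.inv_def, Matrix.smul_apply, Ring.inverse_eq_inv', smul_eq_mul,
    Matrix.adjugate_apply]
  refine ((differentiableAt_matrix_det hG).inv hdet).mul (differentiableAt_matrix_det fun k l => ?_)
  by_cases hk : k = j
  · subst hk; simp
  · simpa [Matrix.updateRow_ne hk] using hG k l

/-- The derivative of the inverse matrix, `∂ₘ G⁻¹ = - G⁻¹ (∂ₘ G) G⁻¹`. -/
lemma partialDeriv_matrix_inv {b : Module.Basis ι ℝ E} {G : E → Matrix ι ι ℝ} {y : E}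
    (hG : ∀ i j, DifferentiableAt ℝ (fun z => G z i j) y) (hdet : (G y).det ≠ 0) (m i j : ι) :
    partialDeriv b m (fun z => (G z)⁻¹ i j) y
      = -((G y)⁻¹ * Matrix.of (fun p q => partialDeriv b m (fun z => G z p q) y) * (G y)⁻¹) i j := by
  have hinv := differentiableAt_matrix_inv hG hdet
  set D : Matrix ι ι ℝ := Matrix.of (fun p q => partialDeriv b m (fun z => G z p q) y)
  set D' : Matrix ι ι ℝ := Matrix.of (fun p q => partialDeriv b m (fun z => (G z)⁻¹ p q) y)
  have hev : ∀ᶠ z in nhds y, (G z).det ≠ 0 :=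
    (differentiableAt_matrix_det hG).continuousAt.eventually_ne hdet
  -- Differentiate G⁻¹ G = 1, which holds near y because the determinant stays nonzero.
  have key : D' * G y + (G y)⁻¹ * D = 0 := by
    ext p q
    have h1 : partialDeriv b m (fun z => ∑ l, (G z)⁻¹ p l * G z l q) y = 0 := by
      rw [partialDeriv_congr (g := fun _ => (1 : Matrix ι ι ℝ) p q), partialDeriv_const]
      filter_upwards [hev] with z hz
      rw [← Matrix.nonsing_inv_mul (G z) (isUnit_iff_ne_zero.mpr hz), Matrix.mul_apply]
    rw [partialDeriv_sum (f := fun l z => (G z)⁻¹ p l * G z l q)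
        fun l _ => (hinv p l).mul (hG l q)] at h1
    simp only [partialDeriv_mul (hinv _ _) (hG _ _), Finset.sum_add_distrib] at h1
    simpa [Matrix.mul_apply, D, D'] using h1
  have hu : IsUnit (G y).det := isUnit_iff_ne_zero.mpr hdet
  have : D' = -((G y)⁻¹ * D * (G y)⁻¹) := by
    have h2 : D' * G y = -((G y)⁻¹ * D) := eq_neg_of_add_eq_zero_left key
    calc D' = D' * G y * (G y)⁻¹ := by rw [Matrix.mul_assoc, Matrix.mul_nonsing_inv _ hu,
          Matrix.mul_one]
      _ = _ := by rw [h2, Matrix.neg_mul]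
  exact congrFun (congrFun this i) j

/-- The components of the Ricci tensor of a metric with the given first and second partial
derivatives, at a point at which the metric is diagonal. -/
def diagRicci (a : ι → ℝ) (d : ι → ι → ι → ℝ) (h : ι → ι → ι → ι → ℝ) (i j : ι) : ℝ :=
  let Γ₁ : ι → ι → ι → ℝ := fun k i j => 1 / 2 * (d j k i + d i k j - d i j k)
  let dΓ₁ : ι → ι → ι → ι → ℝ := fun m k i j => 1 / 2 * (h j k m i + h i k m j - h i j m k)
  let Γ : ι → ι → ι → ℝ := fun k i j => Γ₁ k i j / a k
  let dΓ : ι → ι → ι → ι → ℝ := fun m k i j =>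
    dΓ₁ m k i j / a k - ∑ l, d k l m * Γ₁ l i j / (a k * a l)
  ∑ k, (dΓ k k i j - dΓ j k i k + ∑ l, (Γ k k l * Γ l i j - Γ k j l * Γ l i k))

/-- The Ricci tensor at a point depends only on the 2-jet of the metric there. Diagonality is needed
at the point alone: it collapses the sums over G⁻¹, and the derivative of G⁻¹ becomes -∂G/(aₖ aₗ).
-/
lemma coordRicci_eq_diagRicci {b : Module.Basis ι ℝ E} {G : E → Matrix ι ι ℝ} {y : E}
    {a : ι → ℝ} {d : ι → ι → ι → ℝ} {h : ι → ι → ι → ι → ℝ} (ha : ∀ i, a i ≠ 0)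
    (hG : ∀ i j, HasTwoJet b (fun z => G z i j) y (Matrix.diagonal a i j) (d i j) (h i j))
    (i j : ι) : coordRicci b G y i j = diagRicci a d h i j := by
  have hGy : G y = Matrix.diagonal a := by
    ext p q; exact (hG p q).value
  have hdet : (G y).det ≠ 0 := by
    rw [hGy, Matrix.det_diagonal]; exact Finset.prod_ne_zero_iff.mpr fun i _ => ha i
  have hinv : (G y)⁻¹ = Matrix.diagonal (fun i => (a i)⁻¹) := by
    rw [hGy]
    apply Matrix.inv_eq_right_inv
    rw [Matrix.diagonal_mul_diagonal]
    simp [ha]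
  have hd := fun i j => (hG i j).differentiableAt
  have hdinv := differentiableAt_matrix_inv hd hdet
  have hdd := fun i j k => differentiableAt_partialDeriv (hG i j).contDiffAt (b := b) (k := k)
  have hΓ : ∀ k i j, christoffel b G k i j y
      = (1 / 2 * (d j k i + d i k j - d i j k)) / a k := by
    intro k i j
    simp only [christoffel, hinv, (hG _ _).first, Matrix.diagonal_apply, ite_mul, zero_mul,
      Finset.sum_ite_eq, Finset.mem_univ, if_true]
    ring
  have hdΓ : ∀ m k i j, partialDeriv b m (christoffel b G k i j) y
      = (1 / 2 * (h j k m i + h i k m j - h i j m k)) / a k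
        - ∑ l, d k l m * (1 / 2 * (d j l i + d i l j - d i j l)) / (a k * a l) := by
    intro m k i j
    have e1 : ∀ l, DifferentiableAt ℝ (fun z =>
        (partialDeriv b i (fun z => G z j l) z + partialDeriv b j (fun z => G z i l) z
          - partialDeriv b l (fun z => G z i j) z)) y :=
      fun l => ((hdd j l i).add (hdd i l j)).sub (hdd i j l)
    have e2 : ∀ l, DifferentiableAt ℝ (fun z => (G z)⁻¹ k l *
        (partialDeriv b i (fun z => G z j l) z + partialDeriv b j (fun z => G z i l) z
          - partialDeriv b l (fun z => G z i j) z)) y :=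
      fun l => (hdinv k l).mul (e1 l)
    have e3 : ∀ l, partialDeriv b m (fun z =>
        (partialDeriv b i (fun z => G z j l) z + partialDeriv b j (fun z => G z i l) z
          - partialDeriv b l (fun z => G z i j) z)) y = h j l m i + h i l m j - h i j m l := by
      intro l
      rw [partialDeriv_sub (f := fun z => partialDeriv b i (fun z => G z j l) z
          + partialDeriv b j (fun z => G z i l) z) ((hdd j l i).add (hdd i l j)) (hdd i j l),
        partialDeriv_add (hdd j l i) (hdd i l j), (hG _ _).second, (hG _ _).second, (hG _ _).second]
    rw [show partialDeriv b m (christoffel b G k i j) y = partialDeriv b m (fun z => (1 / 2) *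
        ∑ l, (G z)⁻¹ k l * (partialDeriv b i (fun z => G z j l) z
          + partialDeriv b j (fun z => G z i l) z - partialDeriv b l (fun z => G z i j) z)) y
      from rfl, partialDeriv_mul (differentiableAt_const _) (DifferentiableAt.fun_sum fun l _ => e2 l),
      partialDeriv_const, partialDeriv_sum fun l _ => e2 l]
    simp only [partialDeriv_mul (hdinv _ _) (e1 _),
      e3, (hG _ _).first,
      partialDeriv_matrix_inv hd hdet, hinv, Finset.sum_add_distrib]
    simp only [Matrix.mul_diagonal, Matrix.diagonal_mul, Matrix.of_apply,
      Matrix.diagonal_apply, ite_mul, zero_mul, Finset.sum_ite_eq, Finset.mem_univ, if_true,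
      zero_add, mul_add, Finset.mul_sum]
    rw [add_comm, sub_eq_add_neg _ (∑ l, _), ← Finset.sum_neg_distrib]
    congr 1
    · field_simp
    · refine Finset.sum_congr rfl fun l _ => ?_
      have := ha k; have := ha l
      field_simp
  simp only [coordRicci, diagRicci, hΓ, hdΓ]

end Jets

/-! ### The central projection chart and the invariant forms in it -/

section Chart

/-- The quaternion with the given coordinates. -/
def quat (a b c d : ℝ) : ℍ[ℝ] := ⟨a, b, c, d⟩

@[simp] lemma quat_re (a b c d : ℝ) : (quat a b c d).re = a := rfl
@[simp] lemma quat_imI (a b c d : ℝ) : (quat a b c d).imI = b := rfl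
@[simp] lemma quat_imJ (a b c d : ℝ) : (quat a b c d).imJ = c := rfl
@[simp] lemma quat_imK (a b c d : ℝ) : (quat a b c d).imK = d := rfl

/-- The central projection of `ℝ³`, as the affine space of quaternions of real part `1`, to the unit
sphere. -/
def gnomonicInv (y : EuclideanSpace ℝ (Fin 3)) : ℍ[ℝ] :=
  (√(1 + (y 0 ^ 2 + y 1 ^ 2 + y 2 ^ 2)))⁻¹ • quat 1 (y 0) (y 1) (y 2)

lemma quat_eq_sum (a b c d : ℝ) : quat a b c d = a • 1 + b • quat 0 1 0 0 + c • quat 0 0 1 0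
    + d • quat 0 0 0 1 := by
  ext <;> simp

lemma contDiff_gnomonicInv : ContDiff ℝ ∞ gnomonicInv := by
  have h : gnomonicInv = fun y => (√(1 + (y 0 ^ 2 + y 1 ^ 2 + y 2 ^ 2)))⁻¹ •
      ((1 : ℝ) • (1 : ℍ[ℝ]) + y 0 • quat 0 1 0 0 + y 1 • quat 0 0 1 0 + y 2 • quat 0 0 0 1) :=
    funext fun y => by rw [← quat_eq_sum, gnomonicInv]
  rw [h]
  refine ContDiff.smul (ContDiff.inv (ContDiff.sqrt (by fun_prop) fun y => by positivity)
    fun y => by positivity) (by fun_prop)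

lemma gnomonicInv_mem_sphere (y : EuclideanSpace ℝ (Fin 3)) :
    gnomonicInv y ∈ Metric.sphere (0 : ℍ[ℝ]) 1 := by
  have h1 : 0 < √(1 + (y 0 ^ 2 + y 1 ^ 2 + y 2 ^ 2)) := by positivity
  have h2 := Real.sq_sqrt (show 0 ≤ 1 + (y 0 ^ 2 + y 1 ^ 2 + y 2 ^ 2) by positivity)
  rw [mem_sphere_zero_iff_norm, ← pow_eq_one_iff_of_nonneg (norm_nonneg _) two_ne_zero,
    sq, ← Quaternion.normSq_eq_norm_mul_self, Quaternion.normSq_def']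
  simp only [gnomonicInv, Quaternion.re_smul, Quaternion.imI_smul, Quaternion.imJ_smul,
    Quaternion.imK_smul, smul_eq_mul, quat_re, quat_imI, quat_imJ, quat_imK]
  field_simp
  linarith

/-- The imaginary part divided by the real part. -/
def gnomonic (q : ℍ[ℝ]) : EuclideanSpace ℝ (Fin 3) :=
  !₂[q.imI / q.re, q.imJ / q.re, q.imK / q.re]

/-- The real part of a quaternion, as a continuous linear map. -/
def reCLM : ℍ[ℝ] →L[ℝ] ℝ := LinearMap.toContinuousLinearMap
  (QuaternionAlgebra.reₗ (-1 : ℝ) 0 (-1))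

/-- The `i`-coordinate of a quaternion, as a continuous linear map. -/
def imICLM : ℍ[ℝ] →L[ℝ] ℝ := LinearMap.toContinuousLinearMap
  (QuaternionAlgebra.imIₗ (-1 : ℝ) 0 (-1))

/-- The `j`-coordinate of a quaternion, as a continuous linear map. -/
def imJCLM : ℍ[ℝ] →L[ℝ] ℝ := LinearMap.toContinuousLinearMap
  (QuaternionAlgebra.imJₗ (-1 : ℝ) 0 (-1))

/-- The `k`-coordinate of a quaternion, as a continuous linear map. -/
def imKCLM : ℍ[ℝ] →L[ℝ] ℝ := LinearMap.toContinuousLinearMap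
  (QuaternionAlgebra.imKₗ (-1 : ℝ) 0 (-1))

@[simp] lemma reCLM_apply (q : ℍ[ℝ]) : reCLM q = q.re := rfl
@[simp] lemma imICLM_apply (q : ℍ[ℝ]) : imICLM q = q.imI := rfl
@[simp] lemma imJCLM_apply (q : ℍ[ℝ]) : imJCLM q = q.imJ := rfl
@[simp] lemma imKCLM_apply (q : ℍ[ℝ]) : imKCLM q = q.imK := rfl

lemma contDiffOn_gnomonic : ContDiffOn ℝ ∞ gnomonic {q | 0 < q.re} := by
  rw [contDiffOn_euclidean]
  intro i
  have h0 : ∀ q ∈ {q : ℍ[ℝ] | 0 < q.re}, reCLM q ≠ 0 := fun q hq => ne_of_gt hq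
  fin_cases i
  · exact imICLM.contDiff.contDiffOn.div reCLM.contDiff.contDiffOn h0
  · exact imJCLM.contDiff.contDiffOn.div reCLM.contDiff.contDiffOn h0
  · exact imKCLM.contDiff.contDiffOn.div reCLM.contDiff.contDiffOn h0

lemma normSq_coe_sphere (q : S3) :
    (q : ℍ[ℝ]).re ^ 2 + (q : ℍ[ℝ]).imI ^ 2 + (q : ℍ[ℝ]).imJ ^ 2 + (q : ℍ[ℝ]).imK ^ 2 = 1 := by
  rw [← Quaternion.normSq_def', Quaternion.normSq_eq_norm_mul_self, norm_eq_of_mem_sphere, one_mul]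

lemma gnomonicInv_gnomonic {q : S3} (hq : 0 < (q : ℍ[ℝ]).re) :
    gnomonicInv (gnomonic q) = q := by
  have h1 : 1 + (((q : ℍ[ℝ]).imI / (q : ℍ[ℝ]).re) ^ 2 + ((q : ℍ[ℝ]).imJ / (q : ℍ[ℝ]).re) ^ 2
      + ((q : ℍ[ℝ]).imK / (q : ℍ[ℝ]).re) ^ 2) = ((q : ℍ[ℝ]).re⁻¹) ^ 2 := by
    field_simp
    linarith [normSq_coe_sphere q]
  have h2 : √(1 + (((q : ℍ[ℝ]).imI / (q : ℍ[ℝ]).re) ^ 2 + ((q : ℍ[ℝ]).imJ / (q : ℍ[ℝ]).re) ^ 2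
      + ((q : ℍ[ℝ]).imK / (q : ℍ[ℝ]).re) ^ 2)) = (q : ℍ[ℝ]).re⁻¹ := by
    rw [h1, Real.sqrt_sq (by positivity)]
  simp only [gnomonicInv, gnomonic, PiLp.toLp_apply, Matrix.cons_val]
  rw [h2]
  ext <;> simp <;> field_simp

/-- The central projection of the upper half-sphere as a chart. -/
def gnomonicChart : OpenPartialHomeomorph S3 (EuclideanSpace ℝ (Fin 3)) where
  toFun q := gnomonic q
  invFun y := ⟨gnomonicInv y, gnomonicInv_mem_sphere y⟩
  source := {q | 0 < (q : ℍ[ℝ]).re}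
  target := Set.univ
  map_source' _ _ := Set.mem_univ _
  map_target' y _ := by
    simp only [gnomonicInv, Set.mem_ofPred_eq, Quaternion.re_smul, smul_eq_mul, mul_one, quat_re]
    positivity
  left_inv' q hq := Subtype.ext (gnomonicInv_gnomonic hq)
  right_inv' y _ := by
    have h : √(1 + (y 0 ^ 2 + y 1 ^ 2 + y 2 ^ 2)) ≠ 0 := by positivity
    ext i
    fin_cases i <;> simp [gnomonic, gnomonicInv] <;> field_simp
  open_source := isOpen_lt continuous_const (Quaternion.continuous_re.comp continuous_subtype_val)
  open_target := isOpen_univ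
  continuousOn_toFun := contDiffOn_gnomonic.continuousOn.comp continuous_subtype_val.continuousOn
    fun _ hq => hq
  continuousOn_invFun :=
    (contDiff_gnomonicInv.continuous.subtype_mk gnomonicInv_mem_sphere).continuousOn

lemma contMDiff_gnomonicChart_symm : ContMDiff (𝓡 3) (𝓡 3) ∞ gnomonicChart.symm :=
  ContMDiff.codRestrict_sphere contDiff_gnomonicInv.contMDiff gnomonicInv_mem_sphere

lemma contMDiffOn_gnomonicChart :
    ContMDiffOn (𝓡 3) (𝓡 3) ∞ gnomonicChart gnomonicChart.source :=
  contDiffOn_gnomonic.contMDiffOn.comp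
    (contMDiff_coe_sphere (E := ℍ[ℝ]) (n := 3) (m := ∞)).contMDiffOn fun _ hq => hq

/-- The product of the identity and the central projection, as a chart of `ℝ × S³`. -/
def prodChart : OpenPartialHomeomorph (ℝ × S3) (ModelProd ℝ (EuclideanSpace ℝ (Fin 3))) :=
  (OpenPartialHomeomorph.refl ℝ).prod gnomonicChart

lemma contMDiff_prodChart_symm : ContMDiff model model ∞ prodChart.symm := by
  have h : ContMDiff model model ∞ (fun z : ℝ × EuclideanSpace ℝ (Fin 3) =>
      (z.1, gnomonicChart.symm z.2)) :=
    contMDiff_fst.prodMk (contMDiff_gnomonicChart_symm.comp contMDiff_snd)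
  rw [chartedSpaceSelf_prod] at h
  exact h

/-- The Einstein condition is imposed in every smooth chart, so membership in the atlas allows it to
be read off in this convenient one. -/
lemma prodChart_mem_maximalAtlas : prodChart ∈ IsManifold.maximalAtlas model ∞ (ℝ × S3) := by
  refine OpenPartialHomeomorph.mem_maximalAtlas_of_contMDiffOn _ ?_
    contMDiff_prodChart_symm.contMDiffOn
  have h : ContMDiffOn model model ∞ (fun z : ℝ × S3 => (z.1, gnomonicChart z.2))
      prodChart.source :=
    contMDiffOn_fst.prodMk (contMDiffOn_gnomonicChart.comp contMDiffOn_snd fun x hx => by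
      simpa [prodChart] using hx)
  rw [chartedSpaceSelf_prod] at h
  exact h

/-- The inverse of the chart. -/
def chartInv (z : ℝ × EuclideanSpace ℝ (Fin 3)) : ℝ × S3 :=
  (z.1, ⟨gnomonicInv z.2, gnomonicInv_mem_sphere z.2⟩)

lemma prodChart_extend_target : (prodChart.extend model).target = Set.univ := by
  simp [OpenPartialHomeomorph.extend, prodChart, gnomonicChart]

lemma mdifferentiable_chartInv :
    MDifferentiable 𝓘(ℝ, ℝ × EuclideanSpace ℝ (Fin 3)) model chartInv := by
  refine ContMDiff.mdifferentiable (n := ∞) ?_ (by simp)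
  have h : ContMDiff (𝓘(ℝ, ℝ).prod (𝓡 3)) model ∞ chartInv :=
    contMDiff_fst.prodMk (contMDiff_gnomonicChart_symm.comp contMDiff_snd)
  rw [← modelWithCornersSelf_prod, chartedSpaceSelf_prod] at h
  exact h

lemma mdifferentiable_coe_snd :
    MDifferentiable model 𝓘(ℝ, ℍ[ℝ]) (fun y : ℝ × S3 => (y.2 : ℍ[ℝ])) :=
  (((contMDiff_coe_sphere (E := ℍ[ℝ]) (n := 3) (m := ∞)).comp contMDiff_snd)).mdifferentiable
    (by simp)

lemma dt_chartInv (z v : ℝ × EuclideanSpace ℝ (Fin 3)) :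
    dt (chartInv z) (mfderiv 𝓘(ℝ, ℝ × EuclideanSpace ℝ (Fin 3)) model chartInv z v) = v.1 := by
  have h := mfderiv_comp z (I := 𝓘(ℝ, ℝ × EuclideanSpace ℝ (Fin 3))) (I' := model) (I'' := 𝓘(ℝ, ℝ))
    (g := fun y : ℝ × S3 => y.1) mdifferentiableAt_fst
    (mdifferentiable_chartInv z)
  have h' := congrArg (fun T => T v) h
  rw [dt]
  refine h'.symm.trans ?_
  rw [show (fun y : ℝ × S3 => y.1) ∘ chartInv = Prod.fst from rfl, mfderiv_eq_fderiv]
  erw [fderiv_fst]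
  rfl

lemma maurerCartan_chartInv (z v : ℝ × EuclideanSpace ℝ (Fin 3)) :
    maurerCartan (chartInv z) (mfderiv 𝓘(ℝ, ℝ × EuclideanSpace ℝ (Fin 3)) model chartInv z v)
      = fderiv ℝ gnomonicInv z.2 v.2 * star (gnomonicInv z.2) := by
  have h := mfderiv_comp z (I := 𝓘(ℝ, ℝ × EuclideanSpace ℝ (Fin 3))) (I' := model)
    (I'' := 𝓘(ℝ, ℍ[ℝ])) (mdifferentiable_coe_snd _) (mdifferentiable_chartInv z)
  have h' := congrArg (fun T => T v) h
  rw [maurerCartan]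
  congr 1
  refine h'.symm.trans ?_
  rw [show (fun y : ℝ × S3 => (y.2 : ℍ[ℝ])) ∘ chartInv = gnomonicInv ∘ Prod.snd from rfl,
    mfderiv_eq_fderiv]
  erw [fderiv_comp z (contDiff_gnomonicInv.differentiable (by simp) _) differentiableAt_snd,
    fderiv_snd]
  rfl

/-- For q = r(y)(1 + y), the derivative of the factor r contributes a multiple of q to dq, hence a
real number to dq · q̄. Only imaginary parts matter for the forms, so the real term c is left
unspecified; the square root disappears and the forms are rational in y. -/
lemma fderiv_gnomonicInv_mul_star (y w : EuclideanSpace ℝ (Fin 3)) :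
    ∃ c : ℝ, fderiv ℝ gnomonicInv y w * star (gnomonicInv y)
      = quat c 0 0 0 + (1 + (y 0 ^ 2 + y 1 ^ 2 + y 2 ^ 2))⁻¹ •
        (quat 0 (w 0) (w 1) (w 2) * star (quat 1 (y 0) (y 1) (y 2))) := by
  set r : EuclideanSpace ℝ (Fin 3) → ℝ := fun y => (√(1 + (y 0 ^ 2 + y 1 ^ 2 + y 2 ^ 2)))⁻¹ with hr
  have hr2 : (1 + (y 0 ^ 2 + y 1 ^ 2 + y 2 ^ 2))⁻¹ = r y * r y := by
    rw [hr, ← mul_inv, Real.mul_self_sqrt (by positivity)]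
  have hrd : Differentiable ℝ r := by
    refine ContDiff.differentiable (n := ∞) ?_ (by simp)
    exact ContDiff.inv (ContDiff.sqrt (by fun_prop) fun y => by positivity) fun y => by positivity
  have hQ : HasFDerivAt (fun y : EuclideanSpace ℝ (Fin 3) => quat 1 (y 0) (y 1) (y 2))
      ((EuclideanSpace.proj 0 : EuclideanSpace ℝ (Fin 3) →L[ℝ] ℝ).smulRight (quat 0 1 0 0)
        + (EuclideanSpace.proj 1 : EuclideanSpace ℝ (Fin 3) →L[ℝ] ℝ).smulRight (quat 0 0 1 0)
        + (EuclideanSpace.proj 2 : EuclideanSpace ℝ (Fin 3) →L[ℝ] ℝ).smulRight (quat 0 0 0 1)) y := by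
    have h : (fun y : EuclideanSpace ℝ (Fin 3) => quat 1 (y 0) (y 1) (y 2))
        = fun y => (1 : ℍ[ℝ]) + ((EuclideanSpace.proj 0 : EuclideanSpace ℝ (Fin 3) →L[ℝ] ℝ).smulRight (quat 0 1 0 0)
        + (EuclideanSpace.proj 1 : EuclideanSpace ℝ (Fin 3) →L[ℝ] ℝ).smulRight (quat 0 0 1 0)
        + (EuclideanSpace.proj 2 : EuclideanSpace ℝ (Fin 3) →L[ℝ] ℝ).smulRight (quat 0 0 0 1)) y := by
      funext y
      ext <;> simp
    rw [h]
    exact (ContinuousLinearMap.hasFDerivAt _).const_add _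
  have hd : fderiv ℝ gnomonicInv y w
      = r y • quat 0 (w 0) (w 1) (w 2) + fderiv ℝ r y w • quat 1 (y 0) (y 1) (y 2) := by
    have h := (hrd y).hasFDerivAt.smul hQ
    rw [show gnomonicInv = fun y => r y • quat 1 (y 0) (y 1) (y 2) from rfl]
    erw [h.fderiv]
    ext <;> simp
  refine ⟨fderiv ℝ r y w * r y * (1 + (y 0 ^ 2 + y 1 ^ 2 + y 2 ^ 2)), ?_⟩
  rw [hd, hr2, show gnomonicInv y = r y • quat 1 (y 0) (y 1) (y 2) from rfl]
  ext <;> simp <;> ring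

end Chart

/-! ### The 2-jet of the metric and the Einstein equations -/

section EinsteinEquations

/-- The `t`-coordinate of the standard basis vectors. -/
def basisFst : Unit ⊕ Fin 3 → ℝ
  | .inl _ => 1
  | .inr _ => 0

/-- The `ℝ³`-coordinates of the standard basis vectors. -/
def basisSnd : Unit ⊕ Fin 3 → Fin 3 → ℝ
  | .inl _, _ => 0
  | .inr j, a => if j = a then 1 else 0

lemma stdBasis_fst (i : Unit ⊕ Fin 3) : (stdBasis i).1 = basisFst i := by
  rcases i with i | i <;> simp [stdBasis, basisFst]

lemma stdBasis_snd (i : Unit ⊕ Fin 3) (a : Fin 3) : (stdBasis i).2 a = basisSnd i a := by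
  rcases i with i | i
  · simp [stdBasis, basisSnd]
  · simp [stdBasis, basisSnd, eq_comm]

/-- The components of the invariant 1-forms in the chart. -/
def coframe (a : Fin 3) (i : Unit ⊕ Fin 3) (z : ℝ × EuclideanSpace ℝ (Fin 3)) : ℝ :=
  (1 + (z.2 0 * z.2 0 + z.2 1 * z.2 1 + z.2 2 * z.2 2))⁻¹ *
    (basisSnd i a + (basisSnd i (a + 2) * z.2 (a + 1) + -(basisSnd i (a + 1)) * z.2 (a + 2)))

lemma coframe_eq (i : Unit ⊕ Fin 3) (z : ℝ × EuclideanSpace ℝ (Fin 3)) :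
    e1 (chartInv z) (mfderiv 𝓘(ℝ, ℝ × EuclideanSpace ℝ (Fin 3)) model chartInv z (stdBasis i))
      = coframe 0 i z ∧
    e2 (chartInv z) (mfderiv 𝓘(ℝ, ℝ × EuclideanSpace ℝ (Fin 3)) model chartInv z (stdBasis i))
      = coframe 1 i z ∧
    e3 (chartInv z) (mfderiv 𝓘(ℝ, ℝ × EuclideanSpace ℝ (Fin 3)) model chartInv z (stdBasis i))
      = coframe 2 i z := by
  obtain ⟨c, hc⟩ := fderiv_gnomonicInv_mul_star z.2 (stdBasis i).2
  simp only [e1, e2, e3, maurerCartan_chartInv, hc, stdBasis_snd]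
  refine ⟨?_, ?_, ?_⟩ <;> simp [coframe, show (1 : Fin 3) + 2 = 0 from rfl,
    show (1 : Fin 3) + 1 = 2 from rfl, show (2 : Fin 3) + 2 = 1 from rfl,
    show (2 : Fin 3) + 1 = 0 from rfl] <;> ring

lemma chartMetric_prodChart (A₁ A₂ : ℝ → ℝ) (z : ℝ × EuclideanSpace ℝ (Fin 3))
    (i j : Unit ⊕ Fin 3) :
    chartMetric model stdBasis (metric A₁ A₂) prodChart z i j
      = basisFst i * basisFst j + (A₁ z.1 * A₁ z.1) * (coframe 0 i z * coframe 0 j z)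
        + (A₂ z.1 * A₂ z.1) * (coframe 1 i z * coframe 1 j z + coframe 2 i z * coframe 2 j z) := by
  have h1 := coframe_eq i z
  have h2 := coframe_eq j z
  rw [show chartMetric model stdBasis (metric A₁ A₂) prodChart z i j
    = metric A₁ A₂ (chartInv z)
      (mfderiv 𝓘(ℝ, ℝ × EuclideanSpace ℝ (Fin 3)) model chartInv z (stdBasis i))
      (mfderiv 𝓘(ℝ, ℝ × EuclideanSpace ℝ (Fin 3)) model chartInv z (stdBasis j)) from rfl, metric,
    h1.1, h1.2.1, h1.2.2, h2.1, h2.2.1, h2.2.2, dt_chartInv, dt_chartInv, stdBasis_fst,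
    stdBasis_fst, sq, sq]
  rfl

lemma hasTwoJet_coord (t : ℝ) (a : Fin 3) :
    HasTwoJet stdBasis (fun z : ℝ × EuclideanSpace ℝ (Fin 3) => z.2 a) (t, 0) 0
      (fun k => basisSnd k a) 0 :=
  (HasTwoJet.clm ((EuclideanSpace.proj a : EuclideanSpace ℝ (Fin 3) →L[ℝ] ℝ).comp
    (ContinuousLinearMap.snd ℝ ℝ (EuclideanSpace ℝ (Fin 3))))).congr_jet (by simp)
    (fun k => stdBasis_snd k a) fun _ _ => rfl

lemma hasTwoJet_fst {A : ℝ → ℝ} {t a' a'' : ℝ} (hA : ContDiffAt ℝ 2 A t) (h' : deriv A t = a')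
    (h'' : deriv (deriv A) t = a'') :
    HasTwoJet stdBasis (fun z : ℝ × EuclideanSpace ℝ (Fin 3) => A z.1) (t, 0) (A t)
      (fun k => a' * basisFst k) (fun k l => a'' * basisFst k * basisFst l) := by
  have h := HasTwoJet.clm (b := stdBasis) (y := (t, 0))
    (ContinuousLinearMap.fst ℝ ℝ (EuclideanSpace ℝ (Fin 3)))
  refine (h.comp (F := A) hA h' h'').congr_jet rfl (fun k => ?_) fun k l => ?_
  · simp [stdBasis_fst]
  · simp [stdBasis_fst]

/-- The form is (1 + |y|²)⁻¹ times an affine function of y. To second order at y = 0 the scalar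
factor is 1 - |y|²: the affine part gives the first derivatives, and only the product of -|y|² with
the constant term gives second derivatives. Indices are taken mod 3. -/
lemma hasTwoJet_coframe (t : ℝ) (a : Fin 3) (i : Unit ⊕ Fin 3) :
    HasTwoJet stdBasis (coframe a i) (t, 0) (basisSnd i a)
      (fun k => basisSnd i (a + 2) * basisSnd k (a + 1) - basisSnd i (a + 1) * basisSnd k (a + 2))
      (fun k l => -2 * (basisSnd k 0 * basisSnd l 0 + basisSnd k 1 * basisSnd l 1
        + basisSnd k 2 * basisSnd l 2) * basisSnd i a) := by
  have hc := hasTwoJet_coord t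
  have hs : HasTwoJet stdBasis (fun z : ℝ × EuclideanSpace ℝ (Fin 3) =>
      1 + (z.2 0 * z.2 0 + z.2 1 * z.2 1 + z.2 2 * z.2 2)) (t, 0) 1 0
      (fun k l => 2 * (basisSnd k 0 * basisSnd l 0 + basisSnd k 1 * basisSnd l 1
        + basisSnd k 2 * basisSnd l 2)) := by
    refine ((HasTwoJet.const 1).add ((((hc 0).mul (hc 0)).add ((hc 1).mul (hc 1))).add
      ((hc 2).mul (hc 2)))).congr_jet (by simp) (fun k => by simp) fun k l => ?_
    simp only [Pi.zero_apply]
    ring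
  -- The first two derivatives of 1/x at x = 1, the value of 1 + |y|² at the base point.
  have hr := hs.comp (F := fun x => x⁻¹) (p := -1) (q := 2) (contDiffAt_inv _ one_ne_zero)
    (by simp) (by
      rw [show deriv (fun x : ℝ => x⁻¹) = fun x => -(x ^ 2)⁻¹ from deriv_inv']
      have h : HasDerivAt (fun x : ℝ => -(x ^ 2)⁻¹) _ 1 :=
        ((hasDerivAt_pow 2 (1 : ℝ)).inv (by norm_num)).neg
      rw [h.deriv]
      norm_num)
  have hl := (HasTwoJet.const (b := stdBasis) (y := ((t, 0) : ℝ × EuclideanSpace ℝ (Fin 3)))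
    (basisSnd i a)).add (((HasTwoJet.const (basisSnd i (a + 2))).mul (hc (a + 1))).add
      ((HasTwoJet.const (-(basisSnd i (a + 1)))).mul (hc (a + 2))))
  refine (hr.mul hl).congr_jet (by simp) (fun k => ?_) fun k l => ?_
  · simp
    ring
  · simp

/-- The diagonal entries of the metric at the base point of the chart. -/
def metricDiag (a b : ℝ) : Unit ⊕ Fin 3 → ℝ := Sum.elim 1 ![a * a, b * b, b * b]

/-- The first derivatives of the metric at the base point of the chart. -/
def metricFirst (a a' b b' : ℝ) (i j k : Unit ⊕ Fin 3) : ℝ :=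
  let p : Fin 3 → ℝ := ![a, b, b]
  let p' : Fin 3 → ℝ := ![a', b', b']
  let E : Fin 3 → (Unit ⊕ Fin 3) → (Unit ⊕ Fin 3) → ℝ := fun c i k =>
    basisSnd i (c + 2) * basisSnd k (c + 1) - basisSnd i (c + 1) * basisSnd k (c + 2)
  ∑ c, (2 * p c * p' c * basisFst k * (basisSnd i c * basisSnd j c)
    + p c * p c * (E c i k * basisSnd j c + basisSnd i c * E c j k))

/-- The second derivatives of the metric at the base point of the chart. -/
def metricSecond (a a' a'' b b' b'' : ℝ) (i j k l : Unit ⊕ Fin 3) : ℝ :=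
  let p : Fin 3 → ℝ := ![a, b, b]
  let p' : Fin 3 → ℝ := ![a', b', b']
  let p'' : Fin 3 → ℝ := ![a'', b'', b'']
  let E : Fin 3 → (Unit ⊕ Fin 3) → (Unit ⊕ Fin 3) → ℝ := fun c i k =>
    basisSnd i (c + 2) * basisSnd k (c + 1) - basisSnd i (c + 1) * basisSnd k (c + 2)
  let F : Fin 3 → (Unit ⊕ Fin 3) → (Unit ⊕ Fin 3) → (Unit ⊕ Fin 3) → ℝ := fun c i k l =>
    -2 * (basisSnd k 0 * basisSnd l 0 + basisSnd k 1 * basisSnd l 1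
        + basisSnd k 2 * basisSnd l 2) * basisSnd i c
  ∑ c, (2 * (p'' c * p c + p' c * p' c) * basisFst k * basisFst l * (basisSnd i c * basisSnd j c)
    + 2 * p c * p' c * basisFst k * (E c i l * basisSnd j c + basisSnd i c * E c j l)
    + 2 * p c * p' c * basisFst l * (E c i k * basisSnd j c + basisSnd i c * E c j k)
    + p c * p c * (F c i k l * basisSnd j c + E c i l * E c j k + E c i k * E c j l
      + basisSnd i c * F c j k l))

lemma hasTwoJet_chartMetric {A₁ A₂ : ℝ → ℝ} {t a' a'' b' b'' : ℝ} (hA₁ : ContDiffAt ℝ 2 A₁ t)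
    (h₁ : deriv A₁ t = a') (h₁' : deriv (deriv A₁) t = a'') (hA₂ : ContDiffAt ℝ 2 A₂ t)
    (h₂ : deriv A₂ t = b') (h₂' : deriv (deriv A₂) t = b'') (i j : Unit ⊕ Fin 3) :
    HasTwoJet stdBasis (fun z => chartMetric model stdBasis (metric A₁ A₂) prodChart z i j) (t, 0)
      (Matrix.diagonal (metricDiag (A₁ t) (A₂ t)) i j) (metricFirst (A₁ t) a' (A₂ t) b' i j)
      (metricSecond (A₁ t) a' a'' (A₂ t) b' b'' i j) := by
  have j1 := hasTwoJet_fst hA₁ h₁ h₁'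
  have j2 := hasTwoJet_fst hA₂ h₂ h₂'
  have c := hasTwoJet_coframe t
  simp only [chartMetric_prodChart]
  refine (((HasTwoJet.const (basisFst i * basisFst j)).add
    ((j1.mul j1).mul ((c 0 i).mul (c 0 j)))).add
    ((j2.mul j2).mul (((c 1 i).mul (c 1 j)).add ((c 2 i).mul (c 2 j))))).congr_jet ?_ (fun k => ?_)
    fun k l => ?_
  · rcases i with i | i <;> rcases j with j | j
    · simp [basisFst, basisSnd, metricDiag]
    · simp [basisFst, basisSnd]
    · simp [basisFst, basisSnd]
    · fin_cases i <;> fin_cases j <;> simp [basisFst, basisSnd, metricDiag]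
  · simp only [metricFirst, Fin.sum_univ_three, Pi.zero_apply]
    simp only [Matrix.cons_val]
    ring
  · simp only [metricSecond, Fin.sum_univ_three, Pi.zero_apply]
    simp only [Matrix.cons_val]
    ring

set_option maxHeartbeats 2000000 in
lemma diagRicci_inl {a a' a'' b b' b'' : ℝ} (ha : a ≠ 0) (hb : b ≠ 0) :
    diagRicci (metricDiag a b) (metricFirst a a' b b') (metricSecond a a' a'' b b' b'')
      (.inl ()) (.inl ()) = -(a'' / a + 2 * (b'' / b)) := by
  simp [diagRicci, Fin.sum_univ_three, metricDiag, metricFirst, metricSecond, basisFst, basisSnd]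
  field_simp
  ring

set_option maxHeartbeats 2000000 in
lemma diagRicci_zero {a a' a'' b b' b'' : ℝ} (ha : a ≠ 0) (hb : b ≠ 0) :
    diagRicci (metricDiag a b) (metricFirst a a' b b') (metricSecond a a' a'' b b' b'')
      (.inr 0) (.inr 0) = (-a'' / a - 2 * a' * b' / (a * b) + 2 * a ^ 2 / b ^ 4) * a ^ 2 := by
  simp [diagRicci, Fin.sum_univ_three, metricDiag, metricFirst, metricSecond, basisFst, basisSnd]
  field_simp
  ring

set_option maxHeartbeats 2000000 in
lemma diagRicci_one {a a' a'' b b' b'' : ℝ} (ha : a ≠ 0) (hb : b ≠ 0) :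
    diagRicci (metricDiag a b) (metricFirst a a' b b') (metricSecond a a' a'' b b' b'')
      (.inr 1) (.inr 1) = (-b'' / b - a' * b' / (a * b) - b' ^ 2 / b ^ 2 + 4 / b ^ 2
        - 2 * a ^ 2 / b ^ 4) * b ^ 2 := by
  simp [diagRicci, Fin.sum_univ_three, metricDiag, metricFirst, metricSecond, basisFst, basisSnd]
  field_simp
  ring

/-- The Einstein equations for the metric `dt² + A₁² (e¹)² + A₂² ((e²)² + (e³)²)`. -/
lemma einstein_equations {J : Set ℝ} {A₁ A₂ : ℝ → ℝ} {Λ t a' a'' b' b'' : ℝ}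
    (hR : RicciEqSMul model stdBasis (metric A₁ A₂) (J ×ˢ Set.univ) Λ) (ht : t ∈ J)
    (ha : A₁ t ≠ 0) (hb : A₂ t ≠ 0) (hA₁ : ContDiffAt ℝ 2 A₁ t)
    (h₁ : deriv A₁ t = a') (h₁' : deriv (deriv A₁) t = a'') (hA₂ : ContDiffAt ℝ 2 A₂ t)
    (h₂ : deriv A₂ t = b') (h₂' : deriv (deriv A₂) t = b'') :
    -(a'' / A₁ t + 2 * (b'' / A₂ t)) = Λ ∧
    -a'' / A₁ t - 2 * a' * b' / (A₁ t * A₂ t) + 2 * A₁ t ^ 2 / A₂ t ^ 4 = Λ ∧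
    -b'' / A₂ t - a' * b' / (A₁ t * A₂ t) - b' ^ 2 / A₂ t ^ 2 + 4 / A₂ t ^ 2
      - 2 * A₁ t ^ 2 / A₂ t ^ 4 = Λ := by
  have hJ := hasTwoJet_chartMetric hA₁ h₁ h₁' hA₂ h₂ h₂'
  have hdiag : ∀ i, metricDiag (A₁ t) (A₂ t) i ≠ 0 := by
    rintro (i | i)
    · simp [metricDiag]
    · fin_cases i <;> simp [metricDiag, ha, hb]
  have key : ∀ i, diagRicci (metricDiag (A₁ t) (A₂ t)) (metricFirst (A₁ t) a' (A₂ t) b')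
      (metricSecond (A₁ t) a' a'' (A₂ t) b' b'') i i = Λ * metricDiag (A₁ t) (A₂ t) i := by
    intro i
    have h := hR prodChart prodChart_mem_maximalAtlas (t, 0)
      (by rw [prodChart_extend_target]; exact Set.mem_univ _) ⟨ht, Set.mem_univ _⟩ i i
    rwa [coordRicci_eq_diagRicci hdiag hJ, (hJ i i).value, Matrix.diagonal_apply_eq] at h
  refine ⟨?_, ?_, ?_⟩
  · have h := key (.inl ())
    rw [diagRicci_inl ha hb] at h
    simpa [metricDiag] using h
  · have h := key (.inr 0)
    rw [diagRicci_zero ha hb, show metricDiag (A₁ t) (A₂ t) (.inr 0) = A₁ t ^ 2 by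
      simp [metricDiag, sq]] at h
    exact mul_right_cancel₀ (pow_ne_zero 2 ha) h
  · have h := key (.inr 1)
    rw [diagRicci_one ha hb, show metricDiag (A₁ t) (A₂ t) (.inr 1) = A₂ t ^ 2 by
      simp [metricDiag, sq]] at h
    exact mul_right_cancel₀ (pow_ne_zero 2 hb) h

end EinsteinEquations

/-! ### The polynomial identities for the six coefficients -/

section Polynomials

lemma quintic_coeff_eq_zero {S : Set ℝ} (hS : S.Infinite) (c : Fin 6 → ℝ)
    (h : ∀ x ∈ S, c 0 + c 1 * x + c 2 * x ^ 2 + c 3 * x ^ 3 + c 4 * x ^ 4 + c 5 * x ^ 5 = 0) :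
    c = 0 := by
  have hp : (∑ i : Fin 6, Polynomial.monomial (i : ℕ) (c i)) = 0 := by
    refine Polynomial.eq_zero_of_infinite_isRoot _ (hS.mono fun x hx => ?_)
    have := h x hx
    simp [Polynomial.IsRoot, Fin.sum_univ_six, Polynomial.eval_monomial]
    linarith
  funext i
  have h2 := congrArg (fun p => Polynomial.coeff p (i : ℕ)) hp
  simpa [Polynomial.finsetSum_coeff, Polynomial.coeff_monomial, Fin.val_inj] using h2

/-- The coefficients of a first-order system for which the Einstein equations hold. -/
lemma system_coefficients {S : Set ℝ} (hS : S.Infinite) {k₁ k₂ k₃ l₁ l₂ l₃ : ℝ}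
    (hA : ∀ x ∈ S, x * (2 * l₁ * x + l₂) *
        (k₁ * x ^ 2 + k₂ * x + k₃ - x * (l₁ * x ^ 2 + l₂ * x + l₃))
      - (k₁ * x ^ 2 + k₂ * x + k₃) * (l₁ * x ^ 2 + l₂ * x + l₃) + x ^ 3 = 0)
    (hB : ∀ x ∈ S, (2 * k₁ * x + k₂) *
        (k₁ * x ^ 2 + k₂ * x + k₃ - x * (l₁ * x ^ 2 + l₂ * x + l₃))
      - x * (l₁ * x ^ 2 + l₂ * x + l₃) ^ 2 + 4 * x - 3 * x ^ 3 = 0)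
    (hF : ∃ x ∈ S, (2 * k₁ * x + k₂ + 2 * x * (2 * l₁ * x + l₂)) ≠ 0) :
    ∃ s : ℝ, (s = 1 ∨ s = -1) ∧
      (k₁ = 2 * s ∧ k₂ = 0 ∧ k₃ = -s ∧ l₁ = 0 ∧ l₂ = s ∧ l₃ = 0) := by
  have a := quintic_coeff_eq_zero hS ![-k₃ * l₃, l₂ * k₃ - k₂ * l₃ - k₃ * l₂,
    2 * l₁ * k₃ + l₂ * (k₂ - l₃) - k₁ * l₃ - k₂ * l₂ - k₃ * l₁,
    2 * l₁ * (k₂ - l₃) + l₂ * (k₁ - l₂) - k₁ * l₂ - k₂ * l₁ + 1,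
    2 * l₁ * (k₁ - l₂) - l₁ * l₂ - k₁ * l₁, -2 * l₁ ^ 2] fun x hx => by
      simp only [Matrix.cons_val]
      linear_combination hA x hx
  have b := quintic_coeff_eq_zero hS ![k₂ * k₃, -l₃ ^ 2 + 4 + 2 * k₁ * k₃ + k₂ * (k₂ - l₃),
    -2 * l₂ * l₃ + 2 * k₁ * (k₂ - l₃) + k₂ * (k₁ - l₂),
    -(l₂ ^ 2 + 2 * l₁ * l₃) - 3 + 2 * k₁ * (k₁ - l₂) - k₂ * l₁,
    -2 * l₁ * l₂ - 2 * k₁ * l₁, -l₁ ^ 2] fun x hx => by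
      simp only [Matrix.cons_val]
      linear_combination hB x hx
  have a0 := congrFun a 0
  have a1 := congrFun a 1
  have a2 := congrFun a 2
  have a3 := congrFun a 3
  have a5 := congrFun a 5
  have b0 := congrFun b 0
  have b1 := congrFun b 1
  have b2 := congrFun b 2
  have b3 := congrFun b 3
  simp only [Matrix.cons_val, Pi.zero_apply] at a0 a1 a2 a3 a5 b0 b1 b2 b3
  clear hA hB a b
  obtain ⟨x, -, hF⟩ := hF
  -- The leading coefficient is -2 l₁²; once it vanishes, the cubic coefficient is 1 - l₂².
  have hl₁ : l₁ = 0 := by simpa using a5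
  subst hl₁
  have hl₂ : l₂ ^ 2 = 1 := by linarith
  have hl₂0 : l₂ ≠ 0 := by rintro rfl; norm_num at hl₂
  -- For k₂ = 0 and k₁ = -l₂ the factor P' + 2xQ' is identically zero, against `hF`. This one
  -- exclusion decides both case distinctions below.
  have hk : k₂ = 0 → k₁ ≠ -l₂ := by
    rintro rfl rfl
    exact hF (by ring)
  have hl₃ : l₃ = 0 := by
    by_contra h
    -- The coefficients `a2` and `a1` reduce to -l₃(k₁ + l₂) and -k₂ l₃.
    have h1 : k₁ = -l₂ := mul_right_cancel₀ h (by linarith)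
    have h2 : k₂ = 0 := mul_right_cancel₀ h (by linarith)
    exact hk h2 h1
  subst hl₃
  have hk₂ : k₂ = 0 := by
    rcases mul_eq_zero.mp b0 with h | h
    · exact h
    · subst h
      -- With k₃ = l₃ = 0, the coefficient `b1` is 4 + k₂².
      nlinarith [sq_nonneg k₂]
  have hk₁ : k₁ = 2 * l₂ := by
    have : (k₁ - 2 * l₂) * (k₁ + l₂) = 0 := by
      rw [hk₂] at b3
      linear_combination b3 / 2 - 3 / 2 * hl₂
    rcases mul_eq_zero.mp this with h | h
    · linarith
    · exact absurd (by linarith) (hk hk₂)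
  have hk₃ : k₃ = -l₂ := by
    subst hk₂ hk₁
    refine mul_left_cancel₀ hl₂0 ?_
    linear_combination b1 / 4 + hl₂
  exact ⟨l₂, mul_self_eq_one_iff.mp (by rw [← sq, hl₂]), hk₁, hk₂, hk₃, rfl, rfl, rfl⟩

end Polynomials

/-! ### From the Einstein equations to explicit solutions -/

section Solutions

variable {J : Set ℝ} {x b : ℝ → ℝ} {s α : ℝ}

/-- The point (x, αb) moves on the unit circle with angular velocity αs. Rotating it back by the
angle φ(t) = α(st + c) gives a vector with zero derivative, equal to (1, 0) at t₀ when c is chosen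
so that φ(t₀) is its argument. -/
lemma trigonometric_solution (hJ : IsOpen J) (hJ' : IsPreconnected J) (hne : J.Nonempty)
    (hα : 0 < α) (hx : ∀ t ∈ J, HasDerivAt x (-s * α ^ 2 * b t) t)
    (hb : ∀ t ∈ J, HasDerivAt b (s * x t) t) (h1 : ∀ t ∈ J, x t ^ 2 + (α * b t) ^ 2 = 1) :
    ∃ c : ℝ, ∀ t ∈ J, x t = Real.cos (α * (s * t + c)) ∧ α * b t = Real.sin (α * (s * t + c)) := by
  obtain ⟨t₀, ht₀⟩ := hne
  obtain ⟨θ, hcos, hsin⟩ : ∃ θ, Real.cos θ = x t₀ ∧ Real.sin θ = α * b t₀ := by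
    have hn : ‖(⟨x t₀, α * b t₀⟩ : ℂ)‖ = 1 := by
      rw [Complex.norm_def, Complex.normSq_mk, ← sq, ← sq, h1 t₀ ht₀, Real.sqrt_one]
    have hn0 : (⟨x t₀, α * b t₀⟩ : ℂ) ≠ 0 := by
      intro h
      rw [h, norm_zero] at hn
      exact zero_ne_one hn
    refine ⟨Complex.arg ⟨x t₀, α * b t₀⟩, ?_, ?_⟩
    · rw [Complex.cos_arg hn0, hn, div_one]
    · rw [Complex.sin_arg, hn, div_one]
  refine ⟨θ / α - s * t₀, ?_⟩
  set φ : ℝ → ℝ := fun t => α * (s * t + (θ / α - s * t₀)) with hφ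
  have hφ₀ : φ t₀ = θ := by simp only [hφ]; field_simp; ring
  have hφ' : ∀ t, HasDerivAt φ (α * s) t := fun t => by
    simpa using (((hasDerivAt_id t).const_mul s).add_const (θ / α - s * t₀)).const_mul α
  have hU : ∀ t ∈ J, HasDerivAt
      (fun t => x t * Real.cos (φ t) + α * b t * Real.sin (φ t)) 0 t := fun t ht => by
    have h := ((hx t ht).mul (hφ' t).cos).add (((hb t ht).const_mul α).mul (hφ' t).sin)
    refine h.congr_deriv ?_
    ring
  have hV : ∀ t ∈ J, HasDerivAt
      (fun t => α * b t * Real.cos (φ t) - x t * Real.sin (φ t)) 0 t := fun t ht => by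
    have h := (((hb t ht).const_mul α).mul (hφ' t).cos).sub ((hx t ht).mul (hφ' t).sin)
    refine h.congr_deriv ?_
    ring
  intro t ht
  have hU1 := hJ.is_const_of_deriv_eq_zero hJ'
    (fun t ht => (hU t ht).differentiableAt.differentiableWithinAt)
    (fun t ht => (hU t ht).deriv) ht ht₀
  have hV1 := hJ.is_const_of_deriv_eq_zero hJ'
    (fun t ht => (hV t ht).differentiableAt.differentiableWithinAt)
    (fun t ht => (hV t ht).deriv) ht ht₀
  simp only [hφ₀, hcos, hsin] at hU1 hV1
  have hu : x t * Real.cos (φ t) + α * b t * Real.sin (φ t) = 1 := by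
    rw [hU1, ← h1 t₀ ht₀]; ring
  have hv : α * b t * Real.cos (φ t) - x t * Real.sin (φ t) = 0 := by
    rw [hV1]; ring
  have hcs := Real.sin_sq_add_cos_sq (φ t)
  constructor
  · linear_combination (Real.cos (φ t)) * hu - (Real.sin (φ t)) * hv - x t * hcs
  · linear_combination (Real.sin (φ t)) * hu + (Real.cos (φ t)) * hv - α * b t * hcs

/-- The circle is replaced by the hyperbola x² - (αb)² = 1 and rotations by hyperbolic rotations.
The hyperbola has two branches; ε records the one containing the point at t₀. -/
lemma hyperbolic_solution (hJ : IsOpen J) (hJ' : IsPreconnected J) (hne : J.Nonempty)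
    (hα : 0 < α) (hx : ∀ t ∈ J, HasDerivAt x (s * α ^ 2 * b t) t)
    (hb : ∀ t ∈ J, HasDerivAt b (s * x t) t) (h1 : ∀ t ∈ J, x t ^ 2 = 1 + (α * b t) ^ 2) :
    ∃ c ε : ℝ, (ε = 1 ∨ ε = -1) ∧ ∀ t ∈ J, x t = ε * Real.cosh (α * (s * t + c)) ∧
      α * b t = ε * Real.sinh (α * (s * t + c)) := by
  obtain ⟨t₀, ht₀⟩ := hne
  obtain ⟨ε, hε, hε0⟩ : ∃ ε : ℝ, (ε = 1 ∨ ε = -1) ∧ 0 ≤ ε * x t₀ := by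
    rcases le_total 0 (x t₀) with h | h
    · exact ⟨1, Or.inl rfl, by linarith⟩
    · exact ⟨-1, Or.inr rfl, by linarith⟩
  have hε2 : ε ^ 2 = 1 := by rcases hε with rfl | rfl <;> norm_num
  obtain ⟨θ, hcosh, hsinh⟩ : ∃ θ, Real.cosh θ = ε * x t₀ ∧ Real.sinh θ = ε * (α * b t₀) := by
    refine ⟨Real.arsinh (ε * (α * b t₀)), ?_, Real.sinh_arsinh _⟩
    rw [Real.cosh_arsinh, mul_pow, hε2, one_mul, ← h1 t₀ ht₀, ← one_mul (x t₀ ^ 2), ← hε2,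
      ← mul_pow, Real.sqrt_sq hε0]
  refine ⟨θ / α - s * t₀, ε, hε, ?_⟩
  set φ : ℝ → ℝ := fun t => α * (s * t + (θ / α - s * t₀)) with hφ
  have hφ₀ : φ t₀ = θ := by simp only [hφ]; field_simp; ring
  have hφ' : ∀ t, HasDerivAt φ (α * s) t := fun t => by
    simpa using (((hasDerivAt_id t).const_mul s).add_const (θ / α - s * t₀)).const_mul α
  have hU : ∀ t ∈ J, HasDerivAt
      (fun t => x t * Real.cosh (φ t) - α * b t * Real.sinh (φ t)) 0 t := fun t ht => by
    have h := ((hx t ht).mul (hφ' t).cosh).sub (((hb t ht).const_mul α).mul (hφ' t).sinh)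
    refine h.congr_deriv ?_
    ring
  have hV : ∀ t ∈ J, HasDerivAt
      (fun t => α * b t * Real.cosh (φ t) - x t * Real.sinh (φ t)) 0 t := fun t ht => by
    have h := (((hb t ht).const_mul α).mul (hφ' t).cosh).sub ((hx t ht).mul (hφ' t).sinh)
    refine h.congr_deriv ?_
    ring
  intro t ht
  have hU1 := hJ.is_const_of_deriv_eq_zero hJ'
    (fun t ht => (hU t ht).differentiableAt.differentiableWithinAt)
    (fun t ht => (hU t ht).deriv) ht ht₀
  have hV1 := hJ.is_const_of_deriv_eq_zero hJ'
    (fun t ht => (hV t ht).differentiableAt.differentiableWithinAt)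
    (fun t ht => (hV t ht).deriv) ht ht₀
  simp only [hφ₀, hcosh, hsinh] at hU1 hV1
  have hu : x t * Real.cosh (φ t) - α * b t * Real.sinh (φ t) = ε := by
    rw [hU1]; linear_combination ε * h1 t₀ ht₀
  have hv : α * b t * Real.cosh (φ t) - x t * Real.sinh (φ t) = 0 := by
    rw [hV1]; ring
  have hcs := Real.cosh_sq (φ t)
  constructor
  · linear_combination (Real.cosh (φ t)) * hu + (Real.sinh (φ t)) * hv - x t * hcs
  · linear_combination (Real.sinh (φ t)) * hu + (Real.cosh (φ t)) * hv - α * b t * hcs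

/-- The classification of the Einstein metrics with `Λ ≠ 0` that satisfy a first-order system. -/
lemma solutions_of_einstein_system {k₁ k₂ k₃ l₁ l₂ l₃ Λ : ℝ} {A₁ A₂ : ℝ → ℝ} (hJ : IsOpen J)
    (hJ' : IsPreconnected J) (hne : J.Nonempty) (hA₁ : ContDiffOn ℝ ∞ A₁ J)
    (hA₂ : ContDiffOn ℝ ∞ A₂ J) (hA₁_ne : ∀ t ∈ J, A₁ t ≠ 0) (hA₂_ne : ∀ t ∈ J, A₂ t ≠ 0)
    (hR : RicciEqSMul model stdBasis (metric A₁ A₂) (J ×ˢ Set.univ) Λ) (hΛ : Λ ≠ 0)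
    (h₁ : ∀ t ∈ J, HasDerivAt A₁ (k₁ * (A₁ t / A₂ t) ^ 2 + k₂ * (A₁ t / A₂ t) + k₃) t)
    (h₂ : ∀ t ∈ J, HasDerivAt A₂ (l₁ * (A₁ t / A₂ t) ^ 2 + l₂ * (A₁ t / A₂ t) + l₃) t) :
    ∃ s : ℝ, (s = 1 ∨ s = -1) ∧
      (k₁ = 2 * s ∧ k₂ = 0 ∧ k₃ = -s ∧ l₁ = 0 ∧ l₂ = s ∧ l₃ = 0) ∧
      ∃ α : ℝ, 0 < α ∧
        ((∃ c ε : ℝ, (ε = 1 ∨ ε = -1) ∧ ∀ t ∈ J,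
              A₁ t = Real.sin (2 * α * (s * t + c)) / (2 * α) ∧
              A₂ t = ε * (Real.sin (α * (s * t + c)) / α)) ∨
          (∃ c ε : ℝ, (ε = 1 ∨ ε = -1) ∧ ∀ t ∈ J,
              A₁ t = Real.sinh (2 * α * (s * t + c)) / (2 * α) ∧
              A₂ t = ε * (Real.sinh (α * (s * t + c)) / α))) := by
  set x : ℝ → ℝ := fun t => A₁ t / A₂ t with hxdef
  have hx0 : ∀ t ∈ J, x t ≠ 0 := fun t ht => div_ne_zero (hA₁_ne t ht) (hA₂_ne t ht)
  have hA₁x : ∀ t ∈ J, A₁ t = x t * A₂ t := fun t ht => (div_mul_cancel₀ _ (hA₂_ne t ht)).symm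
  have hx' : ∀ t ∈ J, HasDerivAt x ((k₁ * x t ^ 2 + k₂ * x t + k₃
      - x t * (l₁ * x t ^ 2 + l₂ * x t + l₃)) / A₂ t) t := fun t ht => by
    refine ((h₁ t ht).div (h₂ t ht) (hA₂_ne t ht)).congr_deriv ?_
    have := hA₂_ne t ht
    simp only [hxdef]
    field_simp
  have hquad : ∀ p q r : ℝ, ∀ t ∈ J, HasDerivAt (fun t => p * x t ^ 2 + q * x t + r)
      ((2 * p * x t + q) * ((k₁ * x t ^ 2 + k₂ * x t + k₃
        - x t * (l₁ * x t ^ 2 + l₂ * x t + l₃)) / A₂ t)) t := fun p q r t ht => by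
    refine ((((hx' t ht).pow 2).const_mul p).add ((hx' t ht).const_mul q)).add_const r
      |>.congr_deriv ?_
    simp only [Nat.cast_ofNat]
    ring
  have hd2 : ∀ (A : ℝ → ℝ) (p q r : ℝ), (∀ t ∈ J, HasDerivAt A (p * x t ^ 2 + q * x t + r) t) →
      ∀ t ∈ J, deriv (deriv A) t = (2 * p * x t + q) * ((k₁ * x t ^ 2 + k₂ * x t + k₃
        - x t * (l₁ * x t ^ 2 + l₂ * x t + l₃)) / A₂ t) := fun A p q r hA t ht => by
    rw [Filter.EventuallyEq.deriv_eq (f := fun t => p * x t ^ 2 + q * x t + r)]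
    · exact (hquad p q r t ht).deriv
    · filter_upwards [hJ.mem_nhds ht] with u hu using (hA u hu).deriv
  have h₁ : ∀ t ∈ J, HasDerivAt A₁ (k₁ * x t ^ 2 + k₂ * x t + k₃) t := h₁
  have h₂ : ∀ t ∈ J, HasDerivAt A₂ (l₁ * x t ^ 2 + l₂ * x t + l₃) t := h₂
  clear_value x
  have hle : (2 : ℕ∞ω) ≤ ∞ := by exact WithTop.coe_le_coe.mpr le_top
  have hE := fun t (ht : t ∈ J) => einstein_equations hR ht (hA₁_ne t ht) (hA₂_ne t ht)
    ((hA₁.contDiffAt (hJ.mem_nhds ht)).of_le hle) (h₁ t ht).deriv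
    (hd2 A₁ k₁ k₂ k₃ h₁ t ht)
    ((hA₂.contDiffAt (hJ.mem_nhds ht)).of_le hle) (h₂ t ht).deriv
    (hd2 A₂ l₁ l₂ l₃ h₂ t ht)
  have hF : ∀ t ∈ J, (2 * k₁ * x t + k₂ + 2 * x t * (2 * l₁ * x t + l₂)) *
      (k₁ * x t ^ 2 + k₂ * x t + k₃ - x t * (l₁ * x t ^ 2 + l₂ * x t + l₃))
      = -Λ * A₂ t ^ 2 * x t := fun t ht => by
    have h := (hE t ht).1
    rw [← h, hA₁x t ht]
    have := hx0 t ht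
    have := hA₂_ne t ht
    field_simp
  have hA : ∀ t ∈ J, x t * (2 * l₁ * x t + l₂) *
        (k₁ * x t ^ 2 + k₂ * x t + k₃ - x t * (l₁ * x t ^ 2 + l₂ * x t + l₃))
      - (k₁ * x t ^ 2 + k₂ * x t + k₃) * (l₁ * x t ^ 2 + l₂ * x t + l₃) + x t ^ 3 = 0 :=
    fun t ht => by
    have h := sub_eq_zero.mpr ((hE t ht).2.1.trans (hE t ht).1.symm)
    rw [hA₁x t ht] at h
    have h1 := hx0 t ht
    have h2 := hA₂_ne t ht
    -- The polynomial identity times 2/(x A₂²) is the difference of the first two Einstein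
    -- equations.
    rw [← mul_right_inj' (mul_ne_zero two_ne_zero (inv_ne_zero (mul_ne_zero h1
      (pow_ne_zero 2 h2)))), mul_zero, ← h]
    field_simp
    ring
  have hB : ∀ t ∈ J, (2 * k₁ * x t + k₂) *
        (k₁ * x t ^ 2 + k₂ * x t + k₃ - x t * (l₁ * x t ^ 2 + l₂ * x t + l₃))
      - x t * (l₁ * x t ^ 2 + l₂ * x t + l₃) ^ 2 + 4 * x t - 3 * x t ^ 3 = 0 := fun t ht => by
    have h := sub_eq_zero.mpr ((hE t ht).2.2.trans (hE t ht).2.1.symm)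
    rw [hA₁x t ht] at h
    have hA' := hA t ht
    have h1 := hx0 t ht
    have h2 := hA₂_ne t ht
    field_simp at h
    -- The difference of the last two equations still contains xQ'(P - xQ) - PQ, which `hA'`
    -- replaces by -x³.
    linear_combination h + hA'
  obtain ⟨t₀, ht₀⟩ := hne
  have hF0 : ∀ t ∈ J, -Λ * A₂ t ^ 2 * x t ≠ 0 := fun t ht =>
    mul_ne_zero (mul_ne_zero (neg_ne_zero.mpr hΛ) (pow_ne_zero 2 (hA₂_ne t ht))) (hx0 t ht)
  have hS : (x '' J).Infinite := by
    have hc : ContinuousOn x J := fun t ht => (hx' t ht).continuousAt.continuousWithinAt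
    refine (hJ'.image x hc).infinite_of_nontrivial ?_
    -- If x were constant, x' = 0 would give P - xQ = 0, contradicting the nonvanishing of -Λ A₂² x
    -- in `hF`.
    by_contra hsub
    rw [Set.not_nontrivial_iff] at hsub
    have hconst : x =ᶠ[nhds t₀] fun _ => x t₀ := by
      filter_upwards [hJ.mem_nhds ht₀] with u hu
        using hsub (Set.mem_image_of_mem x hu) (Set.mem_image_of_mem x ht₀)
    have h0 : (k₁ * x t₀ ^ 2 + k₂ * x t₀ + k₃ - x t₀ * (l₁ * x t₀ ^ 2 + l₂ * x t₀ + l₃)) / A₂ t₀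
        = 0 := (hx' t₀ ht₀).unique ((hasDerivAt_const t₀ (x t₀)).congr_of_eventuallyEq hconst)
    have h1 := (div_eq_zero_iff.mp h0).resolve_right (hA₂_ne t₀ ht₀)
    exact hF0 t₀ ht₀ (by rw [← hF t₀ ht₀, h1, mul_zero])
  obtain ⟨s, hs, rfl, rfl, rfl, rfl, rfl, rfl⟩ := system_coefficients hS
    (Set.forall_mem_image.mpr hA) (Set.forall_mem_image.mpr hB)
    ⟨x t₀, Set.mem_image_of_mem x ht₀, fun h => hF0 t₀ ht₀ (by rw [← hF t₀ ht₀, h, zero_mul])⟩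
  -- After the substitutions the sign s is carried by the variable `l₂`.
  refine ⟨_, hs, ⟨rfl, rfl, rfl, rfl, rfl, rfl⟩, ?_⟩
  have hs2 : l₂ ^ 2 = 1 := by rcases hs with rfl | rfl <;> norm_num
  -- Now P' + 2xQ' = 6sx and P - xQ = s(x² - 1), so `hF` reads 6x(x² - 1) = -Λ A₂² x.
  have hcons : ∀ t ∈ J, x t ^ 2 = 1 - Λ / 6 * A₂ t ^ 2 := fun t ht => by
    refine mul_right_cancel₀ (mul_ne_zero (show (6 : ℝ) ≠ 0 by norm_num) (hx0 t ht)) ?_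
    linear_combination (hF t ht) - (6 * x t * (x t ^ 2 - 1)) * hs2
  have hxd : ∀ t ∈ J, HasDerivAt x (-l₂ * (Λ / 6) * A₂ t) t := fun t ht => by
    refine (hx' t ht).congr_deriv ?_
    rw [div_eq_iff (hA₂_ne t ht)]
    linear_combination l₂ * hcons t ht
  have hbd : ∀ t ∈ J, HasDerivAt A₂ (l₂ * x t) t := fun t ht =>
    (h₂ t ht).congr_deriv (by ring)
  rcases lt_or_gt_of_ne hΛ with hneg | hpos
  · have hα : 0 < √(-(Λ / 6)) := Real.sqrt_pos.mpr (by linarith)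
    have hα2 : √(-(Λ / 6)) ^ 2 = -(Λ / 6) := Real.sq_sqrt (by linarith)
    set α := √(-(Λ / 6))
    refine ⟨α, hα, Or.inr ?_⟩
    obtain ⟨c, ε, hε, h⟩ := hyperbolic_solution hJ hJ' ⟨t₀, ht₀⟩ hα (s := l₂) (b := A₂)
      (fun t ht => (hxd t ht).congr_deriv (by rw [hα2]; ring)) hbd
      fun t ht => by rw [hcons t ht, mul_pow, hα2]; ring
    have hε2 : ε ^ 2 = 1 := by rcases hε with rfl | rfl <;> norm_num
    refine ⟨c, ε, hε, fun t ht => ?_⟩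
    have h2 : A₂ t = ε * (Real.sinh (α * (l₂ * t + c)) / α) := by
      have := (h t ht).2
      field_simp
      linarith
    refine ⟨?_, h2⟩
    rw [hA₁x t ht, h2, (h t ht).1, mul_assoc 2 α, Real.sinh_two_mul]
    field_simp
    -- Both x and A₂ carry the factor ε, so it cancels in A₁ = x A₂.
    linear_combination Real.sinh (α * (l₂ * t + c)) * hε2
  · have hα : 0 < √(Λ / 6) := Real.sqrt_pos.mpr (by linarith)
    have hα2 : √(Λ / 6) ^ 2 = Λ / 6 := Real.sq_sqrt (by linarith)
    set α := √(Λ / 6)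
    refine ⟨α, hα, Or.inl ?_⟩
    obtain ⟨c, h⟩ := trigonometric_solution hJ hJ' ⟨t₀, ht₀⟩ hα (s := l₂) (b := A₂)
      (fun t ht => (hxd t ht).congr_deriv (by rw [hα2])) hbd
      fun t ht => by rw [hcons t ht, mul_pow, hα2]; ring
    -- The circle is connected, so a shift of c absorbs the sign and ε = 1 suffices.
    refine ⟨c, 1, Or.inl rfl, fun t ht => ?_⟩
    have h2 : A₂ t = 1 * (Real.sin (α * (l₂ * t + c)) / α) := by
      have := (h t ht).2
      field_simp
      linarith
    refine ⟨?_, h2⟩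
    rw [hA₁x t ht, h2, (h t ht).1, mul_assoc 2 α, Real.sin_two_mul]
    field_simp

end Solutions

/-! ### The sphere in ℂ² and the invariant forms -/

section ComplexCoordinates

/-- The complex coordinate `z₁` of a quaternion `q = z₁ + z₂ j`. -/
def coord₁ : ℍ[ℝ] →L[ℝ] ℂ := reCLM.smulRight 1 + imICLM.smulRight Complex.I

/-- The complex coordinate `z₂` of a quaternion `q = z₁ + z₂ j`. -/
def coord₂ : ℍ[ℝ] →L[ℝ] ℂ := imJCLM.smulRight 1 + imKCLM.smulRight Complex.I

@[simp] lemma coord₁_re (q : ℍ[ℝ]) : (coord₁ q).re = q.re := by simp [coord₁]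
@[simp] lemma coord₁_im (q : ℍ[ℝ]) : (coord₁ q).im = q.imI := by simp [coord₁]
@[simp] lemma coord₂_re (q : ℍ[ℝ]) : (coord₂ q).re = q.imJ := by simp [coord₂]
@[simp] lemma coord₂_im (q : ℍ[ℝ]) : (coord₂ q).im = q.imK := by simp [coord₂]

/-- The standard Hermitian product of ℂ² is the ℂ-component of p q̄. This turns Hermitian products
of dq with q and with itself into expressions in the Maurer–Cartan form. -/
lemma coord_mul_star (p q : ℍ[ℝ]) :
    coord₁ p * star (coord₁ q) + coord₂ p * star (coord₂ q)
      = ⟨(p * star q).re, (p * star q).imI⟩ := by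
  apply Complex.ext <;> simp <;> ring

lemma coe_mul_star (q : S3) : (q : ℍ[ℝ]) * star (q : ℍ[ℝ]) = 1 := by
  rw [Quaternion.self_mul_star, Quaternion.normSq_eq_norm_mul_self, norm_eq_of_mem_sphere]
  simp

lemma star_mul_coe (q : S3) : star (q : ℍ[ℝ]) * (q : ℍ[ℝ]) = 1 := by
  rw [Quaternion.star_mul_self, Quaternion.normSq_eq_norm_mul_self, norm_eq_of_mem_sphere]
  simp

/-- The differential of the inclusion of `S³`. -/
def dq (x : ℝ × S3) (v : TangentSpace model x) : ℍ[ℝ] :=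
  mfderiv model 𝓘(ℝ, ℍ[ℝ]) (fun y : ℝ × S3 => (y.2 : ℍ[ℝ])) x v

/-- Differentiate |q|² = 1: tangent vectors are orthogonal to q. -/
lemma maurerCartan_re (x : ℝ × S3) (v : TangentSpace model x) : (maurerCartan x v).re = 0 := by
  have hg : MDifferentiableAt 𝓘(ℝ, ℍ[ℝ]) 𝓘(ℝ, ℝ) (fun q : ℍ[ℝ] => ‖q‖ ^ 2) (x.2 : ℍ[ℝ]) :=
    (hasStrictFDerivAt_norm_sq (x.2 : ℍ[ℝ])).hasFDerivAt.differentiableAt.mdifferentiableAt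
  have h := mfderiv_comp x (I := model) (I' := 𝓘(ℝ, ℍ[ℝ])) (I'' := 𝓘(ℝ, ℝ)) hg
    (mdifferentiable_coe_snd x)
  have hc : (fun q : ℍ[ℝ] => ‖q‖ ^ 2) ∘ (fun y : ℝ × S3 => (y.2 : ℍ[ℝ])) = fun _ => 1 := by
    funext y
    simp
  have h' := congrArg (fun T => T v) h
  rw [hc, mfderiv_const, mfderiv_eq_fderiv,
    (hasStrictFDerivAt_norm_sq (x.2 : ℍ[ℝ])).hasFDerivAt.fderiv] at h'
  have h2 : (0 : ℝ) = 2 * inner ℝ (x.2 : ℍ[ℝ]) (dq x v) := by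
    refine h'.trans ?_
    change (2 • innerSL ℝ (x.2 : ℍ[ℝ])) (dq x v) = _
    simp
  rw [real_inner_comm, Quaternion.inner_def] at h2
  have : (maurerCartan x v).re = (dq x v * star (x.2 : ℍ[ℝ])).re := rfl
  linarith

lemma coord_dq_mul_star (x : ℝ × S3) (v : TangentSpace model x) :
    coord₁ (dq x v) * star (coord₁ x.2) + coord₂ (dq x v) * star (coord₂ x.2)
      = e1 x v * Complex.I := by
  rw [coord_mul_star]
  change (⟨(maurerCartan x v).re, (maurerCartan x v).imI⟩ : ℂ) = _
  apply Complex.ext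
  · simpa using maurerCartan_re x v
  · simp [e1]

/-- Right multiplication by the unit quaternion q̄ preserves p p'̄, so dq may be replaced by dq ·
q̄, whose components are the eʲ. -/
lemma re_coord_dq_mul_star (x : ℝ × S3) (u v : TangentSpace model x) :
    (coord₁ (dq x u) * star (coord₁ (dq x v)) + coord₂ (dq x u) * star (coord₂ (dq x v))).re
      = e1 x u * e1 x v + (e2 x u * e2 x v + e3 x u * e3 x v) := by
  rw [coord_mul_star]
  have h : dq x u * star (dq x v) = maurerCartan x u * star (maurerCartan x v) := by
    rw [show maurerCartan x u = dq x u * star (x.2 : ℍ[ℝ]) from rfl,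
      show maurerCartan x v = dq x v * star (x.2 : ℍ[ℝ]) from rfl, star_mul, star_star,
      mul_assoc, ← mul_assoc (star (x.2 : ℍ[ℝ])), star_mul_coe, one_mul]
  rw [h]
  simp [maurerCartan_re, e1, e2, e3]
  ring

end ComplexCoordinates

/-! ### The lift to ℂ³ and the pull-back of the invariant metric -/

section Lift

/-- The map `(t, z) ↦ (C(t), S(t) z₁, S(t) z₂)`. -/
def lift (C S : ℝ → ℝ) (x : ℝ × S3) : Fin 3 → ℂ :=
  ![C x.1, S x.1 • coord₁ x.2, S x.1 • coord₂ x.2]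

/-- The extension of `lift` to all quaternions. -/
def liftExt (C S : ℝ → ℝ) (x : ℝ × ℍ[ℝ]) : Fin 3 → ℂ :=
  ![C x.1, S x.1 • coord₁ x.2, S x.1 • coord₂ x.2]

variable {C S : ℝ → ℝ}

lemma contDiff_liftExt (hC : ContDiff ℝ ∞ C) (hS : ContDiff ℝ ∞ S) :
    ContDiff ℝ ∞ (liftExt C S) := by
  rw [contDiff_pi]
  intro i
  fin_cases i
  · exact Complex.ofRealCLM.contDiff.comp (hC.comp contDiff_fst)
  · exact (hS.comp contDiff_fst).smul (coord₁.contDiff.comp contDiff_snd)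
  · exact (hS.comp contDiff_fst).smul (coord₂.contDiff.comp contDiff_snd)

lemma contMDiff_coe_prod :
    ContMDiff model 𝓘(ℝ, ℝ × ℍ[ℝ]) ∞ (fun x : ℝ × S3 => (x.1, (x.2 : ℍ[ℝ]))) :=
  contMDiff_fst.prodMk_space
    ((contMDiff_coe_sphere (E := ℍ[ℝ]) (n := 3) (m := ∞)).comp contMDiff_snd)

lemma contMDiff_lift (hC : ContDiff ℝ ∞ C) (hS : ContDiff ℝ ∞ S) :
    ContMDiff model 𝓘(ℝ, Fin 3 → ℂ) ∞ (lift C S) :=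
  (contDiff_liftExt hC hS).contMDiff.comp contMDiff_coe_prod

lemma fderiv_liftExt {C' S' t : ℝ} (hC : HasDerivAt C C' t) (hS : HasDerivAt S S' t)
    (q : ℍ[ℝ]) (w : ℝ × ℍ[ℝ]) :
    fderiv ℝ (liftExt C S) (t, q) w = ![((C' * w.1 : ℝ) : ℂ),
      (S' * w.1) • coord₁ q + S t • coord₁ w.2, (S' * w.1) • coord₂ q + S t • coord₂ w.2] := by
  have h1 : HasFDerivAt (Prod.fst : ℝ × ℍ[ℝ] → ℝ) (ContinuousLinearMap.fst ℝ ℝ ℍ[ℝ]) (t, q) :=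
    hasFDerivAt_fst
  have h2 : HasFDerivAt (Prod.snd : ℝ × ℍ[ℝ] → ℍ[ℝ]) (ContinuousLinearMap.snd ℝ ℝ ℍ[ℝ]) (t, q) :=
    hasFDerivAt_snd
  have hC1 := Complex.ofRealCLM.hasFDerivAt.comp (t, q)
    (HasDerivAt.comp_hasFDerivAt (h₂ := C) (t, q) hC h1)
  have hS1 := (HasDerivAt.comp_hasFDerivAt (h₂ := S) (t, q) hS h1).smul
    ((coord₁.hasFDerivAt (x := q)).comp (t, q) h2)
  have hS2 := (HasDerivAt.comp_hasFDerivAt (h₂ := S) (t, q) hS h1).smul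
    ((coord₂.hasFDerivAt (x := q)).comp (t, q) h2)
  have h : HasFDerivAt (liftExt C S) (ContinuousLinearMap.pi
      (![Complex.ofRealCLM.comp (C' • ContinuousLinearMap.fst ℝ ℝ ℍ[ℝ]),
        S t • coord₁.comp (ContinuousLinearMap.snd ℝ ℝ ℍ[ℝ])
          + (S' • ContinuousLinearMap.fst ℝ ℝ ℍ[ℝ]).smulRight (coord₁ q),
        S t • coord₂.comp (ContinuousLinearMap.snd ℝ ℝ ℍ[ℝ])
          + (S' • ContinuousLinearMap.fst ℝ ℝ ℍ[ℝ]).smulRight (coord₂ q)] :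
        Fin 3 → (ℝ × ℍ[ℝ] →L[ℝ] ℂ))) (t, q) :=
    hasFDerivAt_pi'.mpr fun i => by
      fin_cases i
      · exact hC1
      · exact hS1
      · exact hS2
  rw [h.fderiv]
  funext i
  fin_cases i
  · simp
  · simp [add_comm]
  · simp [add_comm]

/-- The lift factors through the vector space ℝ × ℍ, where the derivative is an ordinary one; the
inclusion contributes the pair (dt, dq). -/
lemma mfderiv_lift (hC : ContDiff ℝ ∞ C) (hS : ContDiff ℝ ∞ S) {x : ℝ × S3} {C' S' : ℝ}
    (hC' : HasDerivAt C C' x.1) (hS' : HasDerivAt S S' x.1) (v : TangentSpace model x) :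
    (mfderiv model 𝓘(ℝ, Fin 3 → ℂ) (lift C S) x v : Fin 3 → ℂ) = ![((C' * dt x v : ℝ) : ℂ),
      (S' * dt x v) • coord₁ x.2 + S x.1 • coord₁ (dq x v),
      (S' * dt x v) • coord₂ x.2 + S x.1 • coord₂ (dq x v)] := by
  have hE : MDifferentiableAt 𝓘(ℝ, ℝ × ℍ[ℝ]) 𝓘(ℝ, Fin 3 → ℂ) (liftExt C S)
      ((fun x : ℝ × S3 => (x.1, (x.2 : ℍ[ℝ]))) x) :=
    ((contDiff_liftExt hC hS).differentiable (by simp) _).mdifferentiableAt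
  have hp : MDifferentiableAt model 𝓘(ℝ, ℝ × ℍ[ℝ]) (fun x : ℝ × S3 => (x.1, (x.2 : ℍ[ℝ]))) x :=
    contMDiff_coe_prod.mdifferentiable (by simp) x
  have h := congrArg (fun T => T v) (mfderiv_comp x hE hp)
  refine (show _ = _ from h).trans ?_
  have h1 : (mfderiv model 𝓘(ℝ, ℝ × ℍ[ℝ]) (fun x : ℝ × S3 => (x.1, (x.2 : ℍ[ℝ]))) x v : ℝ × ℍ[ℝ])
      = (dt x v, dq x v) := by
    have hf := (mdifferentiableAt_fst (I := 𝓘(ℝ, ℝ)) (I' := 𝓡 3) (x := x)).hasMFDerivAt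
    have hq := (mdifferentiable_coe_snd x).hasMFDerivAt
    have hfq : HasMFDerivAt model 𝓘(ℝ, ℝ × ℍ[ℝ]) (fun x : ℝ × S3 => (x.1, (x.2 : ℍ[ℝ]))) x _ :=
      ⟨hf.1.prodMk hq.1, hf.2.prodMk hq.2⟩
    rw [hfq.mfderiv]
    rfl
  rw [mfderiv_eq_fderiv]
  exact (congrArg (fderiv ℝ (liftExt C S) (x.1, (x.2 : ℍ[ℝ]))) h1).trans
    (fderiv_liftExt hC' hS' _ _)

variable {σ α s : ℝ}

lemma herm_lift_self (hσ : σ ^ 2 = 1) (h1 : ∀ t, C t ^ 2 + σ * S t ^ 2 = 1) (x : ℝ × S3) :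
    herm σ (lift C S x) (lift C S x) = σ := by
  have h := coord_mul_star (x.2 : ℍ[ℝ]) x.2
  rw [coe_mul_star] at h
  have h' : coord₁ x.2 * star (coord₁ x.2) + coord₂ x.2 * star (coord₂ x.2) = 1 := by
    rw [h]; apply Complex.ext <;> simp
  have h2 : ((C x.1 ^ 2 + σ * S x.1 ^ 2 : ℝ) : ℂ) = 1 := by rw [h1]; simp
  have h3 : (σ : ℂ) ^ 2 = 1 := by exact_mod_cast hσ
  push_cast at h2
  simp only [herm, lift, Matrix.cons_val, Complex.real_smul, star_mul', Complex.star_def,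
    Complex.conj_ofReal] at h' ⊢
  linear_combination (S x.1 : ℂ) ^ 2 * h' + σ * h2 - (S x.1 : ℂ) ^ 2 * h3

/-- The invariant metric of the space form pulls back to a metric of cohomogeneity one. -/
lemma spaceFormMetric_lift (hσ : σ ^ 2 = 1) (hs : s ^ 2 = 1) (hC : ContDiff ℝ ∞ C)
    (hS : ContDiff ℝ ∞ S) (hC' : ∀ t, HasDerivAt C (-σ * (α * s) * S t) t)
    (hS' : ∀ t, HasDerivAt S (α * s * C t) t) (h1 : ∀ t, C t ^ 2 + σ * S t ^ 2 = 1)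
    (x : ℝ × S3) (u v : TangentSpace model x) :
    spaceFormMetric σ (lift C S x) (mfderiv model 𝓘(ℝ, Fin 3 → ℂ) (lift C S) x u)
      (mfderiv model 𝓘(ℝ, Fin 3 → ℂ) (lift C S) x v)
      = α ^ 2 * (dt x u * dt x v) + (S x.1 * C x.1) ^ 2 * (e1 x u * e1 x v)
        + S x.1 ^ 2 * (e2 x u * e2 x v + e3 x u * e3 x v) := by
  have hZ := herm_lift_self hσ h1 x
  have hself := coord_mul_star (x.2 : ℍ[ℝ]) x.2
  rw [coe_mul_star] at hself
  have hz : coord₁ x.2 * star (coord₁ x.2) + coord₂ x.2 * star (coord₂ x.2) = 1 := by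
    rw [hself]; apply Complex.ext <;> simp
  have hu := coord_dq_mul_star x u
  have hv := congrArg star (coord_dq_mul_star x v)
  have huv := re_coord_dq_mul_star x u v
  set P := coord₁ (dq x u) * star (coord₁ (dq x v)) + coord₂ (dq x u) * star (coord₂ (dq x v))
    with hP
  have hσ' : (σ : ℂ) ^ 2 = 1 := by exact_mod_cast hσ
  have h1' : ((C x.1 : ℂ)) ^ 2 + σ * S x.1 ^ 2 = 1 := by
    have : ((C x.1 ^ 2 + σ * S x.1 ^ 2 : ℝ) : ℂ) = 1 := by rw [h1]; simp
    exact_mod_cast this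
  simp only [spaceFormMetric, mfderiv_lift hC hS (hC' x.1) (hS' x.1), hZ]
  -- The dt-terms cancel because the Hermitian square of the lift is constant; what remains is the
  -- component along the Hopf fibre, i S² e¹.
  have huZ : herm σ ![((-σ * (α * s) * S x.1 * dt x u : ℝ) : ℂ),
      (α * s * C x.1 * dt x u) • coord₁ x.2 + S x.1 • coord₁ (dq x u),
      (α * s * C x.1 * dt x u) • coord₂ x.2 + S x.1 • coord₂ (dq x u)] (lift C S x)
      = (S x.1 ^ 2 * e1 x u : ℝ) * Complex.I := by
    simp only [herm, lift, Matrix.cons_val, Complex.real_smul, star_mul', Complex.star_def,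
      Complex.conj_ofReal] at hz hu ⊢
    push_cast
    linear_combination (α * s * C x.1 * dt x u * S x.1 : ℂ) * hz + (S x.1 : ℂ) ^ 2 * hu
      - (α * s * C x.1 * dt x u * S x.1 : ℂ) * hσ'
  have hZv : herm σ (lift C S x) ![((-σ * (α * s) * S x.1 * dt x v : ℝ) : ℂ),
      (α * s * C x.1 * dt x v) • coord₁ x.2 + S x.1 • coord₁ (dq x v),
      (α * s * C x.1 * dt x v) • coord₂ x.2 + S x.1 • coord₂ (dq x v)]
      = -((S x.1 ^ 2 * e1 x v : ℝ) * Complex.I) := by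
    simp only [herm, lift, Matrix.cons_val, Complex.real_smul, star_mul', Complex.star_def,
      Complex.conj_ofReal, star_add, Complex.conj_conj, Complex.conj_I] at hz hv ⊢
    push_cast
    linear_combination (α * s * C x.1 * dt x v * S x.1 : ℂ) * hz + (S x.1 : ℂ) ^ 2 * hv
      - (α * s * C x.1 * dt x v * S x.1 : ℂ) * hσ'
  have huv' : herm σ ![((-σ * (α * s) * S x.1 * dt x u : ℝ) : ℂ),
      (α * s * C x.1 * dt x u) • coord₁ x.2 + S x.1 • coord₁ (dq x u),
      (α * s * C x.1 * dt x u) • coord₂ x.2 + S x.1 • coord₂ (dq x u)]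
      ![((-σ * (α * s) * S x.1 * dt x v : ℝ) : ℂ),
      (α * s * C x.1 * dt x v) • coord₁ x.2 + S x.1 • coord₁ (dq x v),
      (α * s * C x.1 * dt x v) • coord₂ x.2 + S x.1 • coord₂ (dq x v)]
      = (α ^ 2 * (dt x u * dt x v) : ℝ) + (S x.1 ^ 2 : ℝ) * P
        + (α * s * C x.1 * S x.1 * (dt x v * e1 x u - dt x u * e1 x v) : ℝ) * Complex.I := by
    have hs' : (s : ℂ) ^ 2 = 1 := by exact_mod_cast hs
    rw [hP]
    simp only [herm, Matrix.cons_val, Complex.real_smul, star_mul', Complex.star_def,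
      Complex.conj_ofReal, star_add, Complex.conj_conj, Complex.conj_I] at hz hu hv ⊢
    push_cast
    linear_combination (α ^ 2 * s ^ 2 * C x.1 ^ 2 * dt x v * dt x u : ℂ) * hz
      + (α * s * C x.1 * dt x u * S x.1 : ℂ) * hv + (α * s * C x.1 * dt x v * S x.1 : ℂ) * hu
      + (α ^ 2 * dt x v * dt x u : ℂ) * hs' + (α ^ 2 * s ^ 2 * dt x v * dt x u : ℂ) * h1'
      + (α ^ 2 * s ^ 2 * dt x v * dt x u * σ * S x.1 ^ 2 : ℂ) * hσ'
  rw [huZ, hZv, huv']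
  have hre : (σ * ((α ^ 2 * (dt x u * dt x v) : ℝ) + (S x.1 ^ 2 : ℝ) * P
        + (α * s * C x.1 * S x.1 * (dt x v * e1 x u - dt x u * e1 x v) : ℝ) * Complex.I)
      - (S x.1 ^ 2 * e1 x u : ℝ) * Complex.I * -((S x.1 ^ 2 * e1 x v : ℝ) * Complex.I) : ℂ).re
      = σ * (α ^ 2 * (dt x u * dt x v) + S x.1 ^ 2 * P.re)
        - S x.1 ^ 4 * (e1 x u * e1 x v) := by
    simp only [Complex.sub_re, Complex.add_re, Complex.mul_re,
      Complex.ofReal_re, Complex.ofReal_im, Complex.I_re, Complex.I_im, Complex.neg_re,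
      Complex.neg_im, Complex.mul_im]
    ring
  rw [hre, huv, Complex.ofReal_re, hσ, div_one]
  -- Removing the component along the complex line changes the coefficient of (e¹)² from S² to S² -
  -- σS⁴ = S²C².
  linear_combination (α ^ 2 * (dt x u * dt x v) + S x.1 ^ 2 * (e1 x u * e1 x v +
    (e2 x u * e2 x v + e3 x u * e3 x v))) * hσ - S x.1 ^ 2 * (e1 x u * e1 x v) * h1 x.1

end Lift

/-! ### Polar coordinates and the affine chart as open embeddings -/

section Embedding

lemma injOn_of_hasDerivAt_ne_zero {J : Set ℝ} {T T' : ℝ → ℝ} (hJ : J.OrdConnected)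
    (hT : ∀ t ∈ J, HasDerivAt T (T' t) t) (hT' : ∀ t ∈ J, T' t ≠ 0) : Set.InjOn T J := by
  intro a ha b hb hab
  by_contra hne
  wlog hlt : a < b generalizing a b
  · exact this hb ha hab.symm (Ne.symm hne) (lt_of_le_of_ne (not_lt.mp hlt) (Ne.symm hne))
  obtain ⟨c, hc, hc0⟩ := exists_hasDerivAt_eq_zero hlt
    (fun t ht => (hT t (hJ.out ha hb ht)).continuousAt.continuousWithinAt) hab
    (fun t ht => hT t (hJ.out ha hb (Set.Ioo_subset_Icc_self ht)))
  exact hT' c (hJ.out ha hb (Set.Ioo_subset_Icc_self hc)) hc0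

/-- Polar coordinates `(t, q) ↦ T(t) q` are an open embedding. -/
lemma isOpenEmbedding_polar {J : Set ℝ} {T T' : ℝ → ℝ} (hJ : IsOpen J) (hJ' : J.OrdConnected)
    (hT : ∀ t ∈ J, HasStrictDerivAt T (T' t) t) (hT' : ∀ t ∈ J, T' t ≠ 0)
    (hT0 : ∀ t ∈ J, T t ≠ 0) :
    Topology.IsOpenEmbedding
      (Set.domRestrict (J ×ˢ Set.univ) fun x : ℝ × S3 => T x.1 • (x.2 : ℍ[ℝ])) := by
  have hU : IsOpen (J ×ˢ (Set.univ : Set S3)) := hJ.prod isOpen_univ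
  have hTc : ContinuousOn T J := fun t ht =>
    (hT t ht).hasDerivAt.continuousAt.continuousWithinAt
  refine Topology.IsOpenEmbedding.of_continuous_injective_isOpenMap ?_ ?_ ?_
  · rw [← continuousOn_iff_continuous_domRestrict]
    exact (hTc.comp continuous_fst.continuousOn fun x hx => hx.1).smul
      (continuous_subtype_val.comp continuous_snd).continuousOn
  · rintro ⟨⟨t, q⟩, ht, _⟩ ⟨⟨t', q'⟩, ht', _⟩ h
    replace h : T t • (q : ℍ[ℝ]) = T t' • (q' : ℍ[ℝ]) := h
    have habs : |T t| = |T t'| := by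
      have := congrArg norm h
      simpa [norm_smul] using this
    have hTt : T t = T t' := by
      -- Opposite values would force a zero of T on the interval, by the intermediate value theorem.
      refine (abs_eq_abs.mp habs).resolve_right fun hneg => ?_
      obtain ⟨u, hu, hu0⟩ : (0 : ℝ) ∈ T '' J := by
        have himg := (hJ'.isPreconnected.image T hTc).ordConnected
        rcases le_total 0 (T t') with h0 | h0
        · exact himg.out (Set.mem_image_of_mem T ht) (Set.mem_image_of_mem T ht')
            ⟨by linarith, h0⟩
        · exact himg.out (Set.mem_image_of_mem T ht') (Set.mem_image_of_mem T ht)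
            ⟨h0, by linarith⟩
      exact hT0 u hu hu0
    have htt : t = t' := injOn_of_hasDerivAt_ne_zero hJ' (fun t ht => (hT t ht).hasDerivAt) hT'
      ht ht' hTt
    subst htt
    have hqq : q = q' := Subtype.ext (smul_right_injective _ (hT0 t ht) h)
    subst hqq
    rfl
  · intro O hO
    have hO' : IsOpen (Subtype.val '' O) := hU.isOpenMap_subtype_val O hO
    rw [show Set.domRestrict (J ×ˢ Set.univ) (fun x : ℝ × S3 => T x.1 • (x.2 : ℍ[ℝ])) '' O
      = (fun x : ℝ × S3 => T x.1 • (x.2 : ℍ[ℝ])) '' (Subtype.val '' O) from by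
        rw [Set.image_image]; rfl, isOpen_iff_mem_nhds]
    rintro _ ⟨⟨t, q⟩, hx, rfl⟩
    obtain ⟨W, V, hW, hV, htW, hqV, hWV⟩ := isOpen_prod_iff.mp hO' t q hx
    have hWJ : W ⊆ J := fun u hu => by
      obtain ⟨y, -, hy⟩ := hWV (Set.mk_mem_prod hu hqV)
      have := y.2.1
      rwa [hy] at this
    -- T is open by the inverse function theorem; this is where strict differentiability enters.
    have hTW : IsOpen (T '' W) := by
      rw [isOpen_iff_mem_nhds]
      rintro _ ⟨u, hu, rfl⟩
      rw [← (hT u (hWJ hu)).map_nhds_eq (hT' u (hWJ hu))]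
      exact Filter.image_mem_map (hW.mem_nhds hu)
    have h0 : (0 : ℝ) ∉ T '' W := by
      rintro ⟨u, hu, hu0⟩
      exact hT0 u (hWJ hu) hu0
    refine Filter.mem_of_superset ((IsOpen.smul_sphere one_ne_zero hTW h0 hV).mem_nhds
      (Set.smul_mem_smul (Set.mem_image_of_mem T htW) (Set.mem_image_of_mem _ hqV))) ?_
    rintro _ ⟨_, ⟨u, hu, rfl⟩, _, ⟨p, hp, rfl⟩, rfl⟩
    exact ⟨(u, p), hWV (Set.mk_mem_prod hu hp), rfl⟩

/-- The affine chart `w ↦ [1 : w₁ : w₂]` of the projective plane. -/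
def affineChart (w : ℍ[ℝ]) : ℙ ℂ (Fin 3 → ℂ) :=
  Projectivization.mk ℂ ![1, coord₁ w, coord₂ w] fun h => one_ne_zero (congrFun h 0)

/-- Openness is tested in the quotient topology: the cone over the image of V is open because on v₀
≠ 0 it is the preimage of V under the continuous map v ↦ (v₁/v₀, v₂/v₀). -/
lemma isOpenEmbedding_affineChart : Topology.IsOpenEmbedding affineChart := by
  refine Topology.IsOpenEmbedding.of_continuous_injective_isOpenMap ?_ ?_ ?_
  · refine (continuous_quotient_mk' (s := projectivizationSetoid ℂ (Fin 3 → ℂ))).comp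
      (Continuous.subtype_mk ?_ _)
    refine continuous_pi fun i => ?_
    fin_cases i
    · exact continuous_const
    · exact coord₁.continuous
    · exact coord₂.continuous
  · intro w w' h
    obtain ⟨a, ha⟩ := (Projectivization.mk_eq_mk_iff' ℂ _ _ _ _).mp h
    have h0 : a = 1 := by simpa using congrFun ha 0
    have h1 : coord₁ w' = coord₁ w := by simpa [h0] using congrFun ha 1
    have h2 : coord₂ w' = coord₂ w := by simpa [h0] using congrFun ha 2
    rw [Complex.ext_iff] at h1 h2
    simp only [coord₁_re, coord₁_im, coord₂_re, coord₂_im] at h1 h2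
    exact Quaternion.ext _ _ h1.1.symm h1.2.symm h2.1.symm h2.2.symm
  · intro V hV
    set m : (Fin 3 → ℂ) → ℍ[ℝ] := fun v =>
      quat (v 1 / v 0).re (v 1 / v 0).im (v 2 / v 0).re (v 2 / v 0).im
    have hm : ContinuousOn m {v | v 0 ≠ 0} := by
      have h1 : ContinuousOn (fun v : Fin 3 → ℂ => v 1 / v 0) {v | v 0 ≠ 0} :=
        (continuous_apply 1).continuousOn.div (continuous_apply 0).continuousOn fun v hv => hv
      have h2 : ContinuousOn (fun v : Fin 3 → ℂ => v 2 / v 0) {v | v 0 ≠ 0} :=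
        (continuous_apply 2).continuousOn.div (continuous_apply 0).continuousOn fun v hv => hv
      have hr := Complex.continuous_re
      have hi := Complex.continuous_im
      have : m = fun v => (v 1 / v 0).re • (1 : ℍ[ℝ]) + (v 1 / v 0).im • quat 0 1 0 0
          + (v 2 / v 0).re • quat 0 0 1 0 + (v 2 / v 0).im • quat 0 0 0 1 :=
        funext fun v => quat_eq_sum _ _ _ _
      rw [this]
      exact ((((hr.comp_continuousOn h1).smul continuousOn_const).add
        ((hi.comp_continuousOn h1).smul continuousOn_const)).add
        ((hr.comp_continuousOn h2).smul continuousOn_const)).add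
        ((hi.comp_continuousOn h2).smul continuousOn_const)
    have hopen : IsOpen ({v : Fin 3 → ℂ | v 0 ≠ 0} ∩ m ⁻¹' V) :=
      hm.isOpen_inter_preimage (isOpen_ne_fun (continuous_apply 0) continuous_const) hV
    have hpre : (Quotient.mk (projectivizationSetoid ℂ (Fin 3 → ℂ))) ⁻¹' (affineChart '' V)
        = Subtype.val ⁻¹' ({v : Fin 3 → ℂ | v 0 ≠ 0} ∩ m ⁻¹' V) := by
      ext ⟨v, hv⟩
      constructor
      · rintro ⟨w, hw, h⟩
        obtain ⟨a, ha⟩ := (Projectivization.mk_eq_mk_iff' ℂ v ![1, coord₁ w, coord₂ w] hv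
          (fun h => one_ne_zero (congrFun h 0))).mp h.symm
        have h0 : a = v 0 := by simpa using congrFun ha 0
        have h1 : a * coord₁ w = v 1 := by simpa using congrFun ha 1
        have h2 : a * coord₂ w = v 2 := by simpa using congrFun ha 2
        have ha0 : a ≠ 0 := by
          rintro rfl
          exact hv (by rw [← ha, zero_smul])
        refine ⟨show v 0 ≠ 0 from h0 ▸ ha0, ?_⟩
        have : m v = w := by
          simp only [m, ← h0, ← h1, ← h2, mul_div_cancel_left₀ _ ha0]
          ext <;> simp
        exact (show m v ∈ V from this.symm ▸ hw)
      · rintro ⟨h0, hmV⟩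
        refine ⟨m v, hmV, ?_⟩
        refine (Projectivization.mk_eq_mk_iff' ℂ _ v _ hv).mpr ⟨(v 0)⁻¹, ?_⟩
        have h0 : v 0 ≠ 0 := h0
        funext i
        fin_cases i
        · simp [h0]
        · apply Complex.ext <;> simp [m, div_eq_inv_mul]
        · apply Complex.ext <;> simp [m, div_eq_inv_mul]
    have hq : IsOpen ((Quotient.mk (projectivizationSetoid ℂ (Fin 3 → ℂ))) ⁻¹' (affineChart '' V)) :=
      hpre ▸ hopen.preimage continuous_subtype_val
    exact isQuotientMap_quotient_mk'.isOpen_preimage.mp hq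

end Embedding

/-! ### The isometry onto an open subset of the space form -/

section Isometry

variable {C S : ℝ → ℝ} {σ α s : ℝ}

lemma lift_ne_zero (hσ : σ ^ 2 = 1) (h1 : ∀ t, C t ^ 2 + σ * S t ^ 2 = 1) (x : ℝ × S3) :
    lift C S x ≠ 0 := by
  intro h
  have h2 := herm_lift_self hσ h1 x
  rw [h] at h2
  have : σ = 0 := by simpa [herm] using h2.symm
  rw [this] at hσ
  norm_num at hσ

lemma mk_lift_eq_affineChart {x : ℝ × S3} (h : lift C S x ≠ 0) (hC : C x.1 ≠ 0) :
    Projectivization.mk ℂ (lift C S x) h = affineChart ((S x.1 / C x.1) • (x.2 : ℍ[ℝ])) := by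
  refine (Projectivization.mk_eq_mk_iff' ℂ _ _ _ _).mpr ⟨C x.1, ?_⟩
  have hC' : (C x.1 : ℂ) ≠ 0 := Complex.ofReal_ne_zero.mpr hC
  funext i
  fin_cases i
  · simp [lift]
  · simp [lift]; field_simp
  · simp [lift]; field_simp

lemma herm_smul_re (a : ℂ) (z : Fin 3 → ℂ) :
    (herm σ (a • z) (a • z)).re = Complex.normSq a * (herm σ z z).re := by
  have : herm σ (a • z) (a • z) = (Complex.normSq a : ℂ) * herm σ z z := by
    rw [Complex.normSq_eq_conj_mul_self]
    simp only [herm, Pi.smul_apply, smul_eq_mul, star_mul', Complex.star_def]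
    ring
  rw [this, Complex.re_ofReal_mul]

/-- The metrics with `A₁ = S C / α` and `A₂ = S / α` up to sign are isometric to open subsets of a
complex space form. -/
lemma exists_isIsometryOntoOpen {J : Set ℝ} {A₁ A₂ : ℝ → ℝ} (hJ : IsOpen J)
    (hJ' : J.OrdConnected) (hα : 0 < α) (hσ : σ ^ 2 = 1) (hs : s ^ 2 = 1) (hC : ContDiff ℝ ∞ C)
    (hS : ContDiff ℝ ∞ S) (hC' : ∀ t, HasDerivAt C (-σ * (α * s) * S t) t)
    (hS' : ∀ t, HasDerivAt S (α * s * C t) t) (h1 : ∀ t, C t ^ 2 + σ * S t ^ 2 = 1)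
    (hC0 : ∀ t ∈ J, C t ≠ 0) (hS0 : ∀ t ∈ J, S t ≠ 0)
    (hA₁ : ∀ t ∈ J, A₁ t ^ 2 = (S t * C t / α) ^ 2) (hA₂ : ∀ t ∈ J, A₂ t ^ 2 = (S t / α) ^ 2) :
    ∃ f, IsIsometryOntoOpen σ (1 / α ^ 2) (metric A₁ A₂) (J ×ˢ Set.univ) f := by
  refine ⟨fun x => Projectivization.mk ℂ (lift C S x) (lift_ne_zero hσ h1 x), ?_, ?_, ?_⟩
  · intro x _
    obtain ⟨a, ha⟩ := Projectivization.exists_smul_eq_mk_rep ℂ (lift C S x) (lift_ne_zero hσ h1 x)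
    change 0 < σ * (herm σ (Projectivization.mk ℂ (lift C S x) (lift_ne_zero hσ h1 x)).rep
      (Projectivization.mk ℂ (lift C S x) (lift_ne_zero hσ h1 x)).rep).re
    rw [← ha, Units.smul_def, herm_smul_re, herm_lift_self hσ h1, Complex.ofReal_re]
    have : 0 < Complex.normSq a := Complex.normSq_pos.mpr a.ne_zero
    nlinarith
  -- In the affine chart the map is polar coordinates with radius S/C. The numerator of its
  -- derivative is αs(C² + σS²) = αs, so it never vanishes.
  · have hT : ∀ t ∈ J, HasStrictDerivAt (fun t => S t / C t) (α * s / C t ^ 2) t :=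
      fun t ht => by
        refine ((hS.contDiffAt.hasStrictDerivAt' (hS' t) (by simp)).div
          (hC.contDiffAt.hasStrictDerivAt' (hC' t) (by simp)) (hC0 t ht)).congr_deriv ?_
        congr 1
        linear_combination α * s * h1 t
    have hs0 : s ≠ 0 := by rintro rfl; norm_num at hs
    have h := isOpenEmbedding_affineChart.comp (isOpenEmbedding_polar hJ hJ' hT
      (fun t ht => div_ne_zero (mul_ne_zero hα.ne' hs0) (pow_ne_zero 2 (hC0 t ht)))
      fun t ht => div_ne_zero (hS0 t ht) (hC0 t ht))
    convert h using 1
    funext x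
    exact mk_lift_eq_affineChart _ (hC0 _ x.2.1)
  · intro x hx
    refine ⟨J ×ˢ Set.univ, hJ.prod isOpen_univ, hx, subset_rfl, lift C S,
      (contMDiff_lift hC hS).contMDiffOn, fun y hy => ⟨⟨lift_ne_zero hσ h1 y, rfl⟩, fun u v => ?_⟩⟩
    rw [spaceFormMetric_lift hσ hs hC hS hC' hS' h1, metric, hA₁ _ hy.1, hA₂ _ hy.1]
    field_simp

end Isometry

end CohomogeneityOne

end

/-! ### The classification -/

theorem theorem2 (k₁ k₂ k₃ l₁ l₂ l₃ : ℝ) (J : Set ℝ) (hJ_open : IsOpen J)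
    (hJ_conn : J.OrdConnected) (A₁ A₂ : ℝ → ℝ)
    (hA₁ : ContDiffOn ℝ ∞ A₁ J) (hA₂ : ContDiffOn ℝ ∞ A₂ J)
    (hA₁_ne : ∀ t ∈ J, A₁ t ≠ 0) (hA₂_ne : ∀ t ∈ J, A₂ t ≠ 0)
    (hEinstein : CohomogeneityOne.IsEinstein CohomogeneityOne.model CohomogeneityOne.stdBasis
      (CohomogeneityOne.metric A₁ A₂) (J ×ˢ Set.univ))
    (hNotFlat : ¬ CohomogeneityOne.IsRicciFlat CohomogeneityOne.model CohomogeneityOne.stdBasis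
      (CohomogeneityOne.metric A₁ A₂) (J ×ˢ Set.univ))
    (hDistinct : ∃ t ∈ J, A₁ t ≠ A₂ t)
    (hSystem₁ : ∀ t ∈ J,
      HasDerivAt A₁ (k₁ * (A₁ t / A₂ t) ^ 2 + k₂ * (A₁ t / A₂ t) + k₃) t)
    (hSystem₂ : ∀ t ∈ J,
      HasDerivAt A₂ (l₁ * (A₁ t / A₂ t) ^ 2 + l₂ * (A₁ t / A₂ t) + l₃) t) :
    ∃ s : ℝ, (s = 1 ∨ s = -1) ∧
      (k₁ = 2 * s ∧ k₂ = 0 ∧ k₃ = -s ∧ l₁ = 0 ∧ l₂ = s ∧ l₃ = 0) ∧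
      ∃ α : ℝ, 0 < α ∧
        (((∃ c ε : ℝ, (ε = 1 ∨ ε = -1) ∧ ∀ t ∈ J,
              A₁ t = Real.sin (2 * α * (s * t + c)) / (2 * α) ∧
              A₂ t = ε * (Real.sin (α * (s * t + c)) / α)) ∧
            ∃ f, CohomogeneityOne.IsIsometryOntoOpen 1 (1 / α ^ 2)
              (CohomogeneityOne.metric A₁ A₂) (J ×ˢ Set.univ) f) ∨
          ((∃ c ε : ℝ, (ε = 1 ∨ ε = -1) ∧ ∀ t ∈ J,
              A₁ t = Real.sinh (2 * α * (s * t + c)) / (2 * α) ∧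
              A₂ t = ε * (Real.sinh (α * (s * t + c)) / α)) ∧
            ∃ f, CohomogeneityOne.IsIsometryOntoOpen (-1) (1 / α ^ 2)
              (CohomogeneityOne.metric A₁ A₂) (J ×ˢ Set.univ) f)) := by
  -- Only a point of J is taken from here: for Λ ≠ 0 the ratio A₁/A₂ is nonconstant anyway.
  obtain ⟨t₀, ht₀, -⟩ := hDistinct
  obtain ⟨Λ, hR⟩ := hEinstein
  have hΛ : Λ ≠ 0 := by
    rintro rfl
    exact hNotFlat hR
  obtain ⟨s, hs, hk, α, hα, h⟩ := CohomogeneityOne.solutions_of_einstein_system hJ_open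
    hJ_conn.isPreconnected ⟨t₀, ht₀⟩ hA₁ hA₂ hA₁_ne hA₂_ne hR hΛ hSystem₁ hSystem₂
  have hs2 : s ^ 2 = 1 := by rcases hs with rfl | rfl <;> norm_num
  refine ⟨s, hs, hk, α, hα, ?_⟩
  rcases h with ⟨c, ε, hε, h⟩ | ⟨c, ε, hε, h⟩
  · refine Or.inl ⟨⟨c, ε, hε, h⟩, ?_⟩
    have hε2 : ε ^ 2 = 1 := by rcases hε with rfl | rfl <;> norm_num
    have hφ : ∀ t, HasDerivAt (fun t => α * (s * t + c)) (α * s) t := fun t => by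
      simpa using (((hasDerivAt_id t).const_mul s).add_const c).const_mul α
    have hA : ∀ t ∈ J, A₁ t
        = Real.sin (α * (s * t + c)) * Real.cos (α * (s * t + c)) / α := fun t ht => by
      rw [(h t ht).1, mul_assoc 2 α, Real.sin_two_mul]
      field_simp
    refine CohomogeneityOne.exists_isIsometryOntoOpen (C := fun t => Real.cos (α * (s * t + c)))
      (S := fun t => Real.sin (α * (s * t + c))) hJ_open hJ_conn hα (one_pow 2) hs2
      (by fun_prop) (by fun_prop) (fun t => (hφ t).cos.congr_deriv (by ring))
      (fun t => (hφ t).sin.congr_deriv (by ring))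
      (fun t => by rw [one_mul, Real.cos_sq_add_sin_sq]) (fun t ht h0 => hA₁_ne t ht ?_)
      (fun t ht h0 => hA₁_ne t ht ?_) (fun t ht => by rw [hA t ht]) (fun t ht => ?_)
    -- A zero of the cosine or of the sine would be a zero of A₁ = SC/α.
    · rw [hA t ht, h0, mul_zero, zero_div]
    · rw [hA t ht, h0, zero_mul, zero_div]
    · rw [(h t ht).2, mul_pow, hε2, one_mul]
  · refine Or.inr ⟨⟨c, ε, hε, h⟩, ?_⟩
    have hε2 : ε ^ 2 = 1 := by rcases hε with rfl | rfl <;> norm_num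
    have hφ : ∀ t, HasDerivAt (fun t => α * (s * t + c)) (α * s) t := fun t => by
      simpa using (((hasDerivAt_id t).const_mul s).add_const c).const_mul α
    have hA : ∀ t ∈ J, A₁ t
        = Real.sinh (α * (s * t + c)) * Real.cosh (α * (s * t + c)) / α := fun t ht => by
      rw [(h t ht).1, mul_assoc 2 α, Real.sinh_two_mul]
      field_simp
    refine CohomogeneityOne.exists_isIsometryOntoOpen (C := fun t => Real.cosh (α * (s * t + c)))
      (S := fun t => Real.sinh (α * (s * t + c))) hJ_open hJ_conn hα (by norm_num) hs2
      (by fun_prop) (by fun_prop) (fun t => (hφ t).cosh.congr_deriv (by ring))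
      (fun t => (hφ t).sinh.congr_deriv (by ring))
      (fun t => by rw [Real.cosh_sq]; ring) (fun t ht h0 => (Real.cosh_pos _).ne' h0)
      (fun t ht h0 => hA₁_ne t ht ?_) (fun t ht => by rw [hA t ht]) (fun t ht => ?_)
    · rw [hA t ht, h0, zero_mul, zero_div]
    · rw [(h t ht).2, mul_pow, hε2, one_mul]
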